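/- **Setting.** Fix an optimal machine $U$: a partial computable function $U(p,y)$ on pairs of binary strings such that, with $C_M(x|y)=\min\{|p| : M(p,y)=x\}$, for every partial computable $M$ there is a constant $c_M$ with $C_U(x|y)\le C_M(x|y)+c_M$ for all $x,y$. Write $C(x|y)=C_U(x|y)$, $C(x)=C(x|\Lambda)$ with $\Lambda$ the empty string, let $C$ of a tuple be $C$ of its code under a fixed computable bijection between finite tuples of strings and strings, and let $I(x:y)=C(x)+C(y)-C(x,y)$. The *complexity profile* of $(x,y)$ is the triple $C(x),C(y),I(x:y)$. Let $\theta\in(0,\tfrac12)$ be the number with $h(\theta)=\tfrac12$, where $h(t)=-t\log_2 t-(1-t)\log_2(1-t)$. For a constant $K$, let $\mathcal H_K(n)$ be the set of pairs $(x,y)$ of $n$-bit strings whose Hamming distance is $\theta n$ rounded up or down to an integer and such that each of $I(x:y)$, $C(x|y)$, $C(y|x)$ differs from $n/2$ by at most $K\log(n+2)$. A *protocol* is a uniformly computable two-party protocol with private randomness, given by algorithms that serve inputs of all lengths: for inputs of length $n$, Alice knows $x$ and a private random string $r_A$, Bob knows $y$ and a private random string $r_B$, where $r_A,r_B$ are independent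 and uniform in $\{0,1\}^{m(n)}$ for a computable function $m$; the parties send bits to each other, and the next speaker (or the end of the communication) is determined by $n$ and the bits sent so far. The communication ends on all inputs and all random bits, and each party then computes an answer from the party's own data and the transcript $t$ (the sequence of all bits sent). The communication complexity on length $n$ is the maximum of $|t|$ over all $n$-bit inputs and all random bits. **Theorem.** There is a constant $c$ such that for every $\delta\in(0,1)$ there is a protocol $\pi$ for which: - for every $n$, the communication complexity of $\pi$ on inputs of length $n$ is at most $c\,\delta n$; - for every $K$ there are a function $g(n)=o(n)$ and a constant $D$ such that for every $n$ and every $(x,y)\in\mathcal H_K(n)$, given $x$ and $y$, with probability $>0.99$ over $r_A,r_B$, Alice and Bob obtain the same answer $z$, its length satisfies $|z|\ge \delta n/2-g(n)$, and $z$ is secret in the sense that $$C\bigl(z \mid t,\ \text{complexity profile of }(x,y)\bigr)\ \ge\ |z|-D .$$ In particular, the constant in the communication bound $O(\delta n)$ does not depend on $n$ or $\delta$ (nor on $K$). -/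

import Mathlib

open Filter Asymptotics

/-! ### Kolmogorov complexity -/

/-- A (Turing) machine with a program tape and a condition tape, as the partial function that it
computes: `M p y` is what `M` prints on program `p` and condition `y`, if anything. -/
abbrev Machine : Type := List Bool → List Bool →. List Bool

/-- `C_M(x | y) = min {|p| : M(p, y) = x}`, which is `⊤` if there is no such `p`. -/
noncomputable def Machine.complexity (M : Machine) (x y : List Bool) : ℕ∞ :=
  ⨅ (p : List Bool) (_ : x ∈ M p y), (p.length : ℕ∞)

/-- `U` is an optimal machine: it is computable, and for every computable machine `M` there is a
constant `c` with `C_U(x | y) ≤ C_M(x | y) + c` for all `x` and `y`. -/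
def Machine.IsOptimal (U : Machine) : Prop :=
  Partrec₂ U ∧ ∀ M : Machine, Partrec₂ M →
    ∃ c : ℕ, ∀ x y : List Bool, U.complexity x y ≤ M.complexity x y + c

/-- Conditional Kolmogorov complexity `C(x | y)` as a natural number
(the value `⊤` does not occur if `U` is optimal). -/
noncomputable def condK (U : Machine) (x y : List Bool) : ℕ :=
  (U.complexity x y).toNat

/-- Kolmogorov complexity `C(x) = C(x | Λ)`, where `Λ` is the empty string. -/
noncomputable def plainK (U : Machine) (x : List Bool) : ℕ :=
  condK U x []

/-- Kolmogorov complexity `C(x₁, …, x_k)` of a tuple, for the encoding `code` of tuples of strings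
by strings. -/
noncomputable def tupleK (U : Machine) (code : List (List Bool) ≃ List Bool)
    (xs : List (List Bool)) : ℕ :=
  plainK U (code xs)

/-- Mutual information `I(x : y) = C(x) + C(y) - C(x, y)`. -/
noncomputable def mutualInfo (U : Machine) (code : List (List Bool) ≃ List Bool)
    (x y : List Bool) : ℤ :=
  (plainK U x : ℤ) + plainK U y - tupleK U code [x, y]

/-- Binary notation of an integer: a sign bit, then the binary digits of the absolute value. -/
def intBits (i : ℤ) : List Bool :=
  decide (i < 0) :: i.natAbs.bits

/-- The values `C(x)`, `C(y)`, `I(x : y)`, written in binary. -/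
noncomputable def complexityProfile (U : Machine) (code : List (List Bool) ≃ List Bool)
    (x y : List Bool) : List (List Bool) :=
  [intBits (plainK U x), intBits (plainK U y), intBits (mutualInfo U code x y)]

/-! ### Pairs at a fixed Hamming distance -/

/-- `x` and `y` are `n`-bit strings whose Hamming distance is `θ n` (rounded, up or down, to an
integer) and whose complexity profile is `I(x : y) = C(x | y) = C(y | x) = n / 2 + O(log n)`, with
the constant `K` in the term `O(log n)`. -/
structure IsHammingPair (U : Machine) (code : List (List Bool) ≃ List Bool) (θ K : ℝ) {n : ℕ}
    (x y : Fin n → Bool) : Prop where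
  dist : |(hammingDist x y : ℝ) - θ * n| < 1
  info : |(mutualInfo U code (List.ofFn x) (List.ofFn y) : ℝ) - n / 2| ≤ K * Real.log (n + 2)
  cond_left : |(condK U (List.ofFn x) (List.ofFn y) : ℝ) - n / 2| ≤ K * Real.log (n + 2)
  cond_right : |(condK U (List.ofFn y) (List.ofFn x) : ℝ) - n / 2| ≤ K * Real.log (n + 2)

/-! ### Two-party communication protocols with private randomness -/

/-- The rules of a two-party protocol with private randomness, for inputs of all lengths.
The parties send one bit at a time; `t` is the list of the bits sent so far. -/
structure ProtocolRules where
  /-- the number of private random bits of each party, for inputs of length `n` -/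
  coins : ℕ → ℕ
  /-- who sends the next bit, for inputs of length `n`, after the bits `t`: `some true` is Alice,
  `some false` is Bob, and `none` means that the communication is over -/
  turn : ℕ → List Bool → Option Bool
  /-- the next bit of Alice, on `(x, rA, t)` -/
  bitA : List Bool × List Bool × List Bool → Bool
  /-- the next bit of Bob, on `(y, rB, t)` -/
  bitB : List Bool × List Bool × List Bool → Bool
  /-- the final answer of Alice, on `(x, rA, t)` -/
  outA : List Bool × List Bool × List Bool → List Bool
  /-- the final answer of Bob, on `(y, rB, t)` -/
  outB : List Bool × List Bool × List Bool → List Bool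

namespace ProtocolRules

/-- One step of the communication: the bits `t` are extended by the next one, if there is any. -/
def step (P : ProtocolRules) {n : ℕ} (x y : Fin n → Bool) (rA rB : Fin (P.coins n) → Bool)
    (t : List Bool) : List Bool :=
  match P.turn n t with
  | none => t
  | some true => t ++ [P.bitA (List.ofFn x, List.ofFn rA, t)]
  | some false => t ++ [P.bitB (List.ofFn y, List.ofFn rB, t)]

/-- The bits sent within the first `k` steps. -/
def history (P : ProtocolRules) {n : ℕ} (x y : Fin n → Bool) (rA rB : Fin (P.coins n) → Bool)
    (k : ℕ) : List Bool :=
  (P.step x y rA rB)^[k] []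

end ProtocolRules

/-- A uniformly computable two-party protocol with private randomness: the same algorithms serve
the inputs of all lengths, and the communication ends on all inputs and for all random bits. -/
structure Protocol extends ProtocolRules where
  coins_computable : Computable coins
  turn_computable : Computable₂ turn
  bitA_computable : Computable bitA
  bitB_computable : Computable bitB
  outA_computable : Computable outA
  outB_computable : Computable outB
  halts : ∀ (n : ℕ) (x y : Fin n → Bool) (rA rB : Fin (coins n) → Bool),
    ∃ k : ℕ, turn n (toProtocolRules.history x y rA rB k) = none

namespace Protocol

/-- The transcript: all bits that the parties send to each other. -/
def transcript (P : Protocol) {n : ℕ} (x y : Fin n → Bool) (rA rB : Fin (P.coins n) → Bool) :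
    List Bool :=
  P.history x y rA rB (Nat.find (P.halts n x y rA rB))

/-- Alice's final answer. -/
def answerA (P : Protocol) {n : ℕ} (x y : Fin n → Bool) (rA rB : Fin (P.coins n) → Bool) :
    List Bool :=
  P.outA (List.ofFn x, List.ofFn rA, P.transcript x y rA rB)

/-- Bob's final answer. -/
def answerB (P : Protocol) {n : ℕ} (x y : Fin n → Bool) (rA rB : Fin (P.coins n) → Bool) :
    List Bool :=
  P.outB (List.ofFn y, List.ofFn rB, P.transcript x y rA rB)

/-- Communication complexity for inputs of length `n`: the maximal length of the transcript over
all inputs and all random bits. -/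
def commComplexity (P : Protocol) (n : ℕ) : ℕ :=
  Finset.univ.sup fun w : ((Fin n → Bool) × (Fin n → Bool)) ×
      ((Fin (P.coins n) → Bool) × (Fin (P.coins n) → Bool)) =>
    (P.transcript w.1.1 w.1.2 w.2.1 w.2.2).length

open Classical in
/-- The probability of an event that depends on the random bits of the two parties, which are
independent and uniformly distributed. -/
noncomputable def prob (P : Protocol) (n : ℕ)
    (E : (Fin (P.coins n) → Bool) → (Fin (P.coins n) → Bool) → Prop) : ℝ :=
  ((Finset.univ.filter fun r : (Fin (P.coins n) → Bool) × (Fin (P.coins n) → Bool) =>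
      E r.1 r.2).card : ℝ) /
    (Fintype.card ((Fin (P.coins n) → Bool) × (Fin (P.coins n) → Bool)) : ℝ)

/-- On inputs `x`, `y` and random bits `rA`, `rB`, the parties agree on a secret key of length at
least `s`: their answers are the same string `z`, with `|z| ≥ s`, and
`C(z | t, complexity profile of (x, y)) ≥ |z| - D`, where `t` is the transcript. -/
def AgreeOnSecretKey (P : Protocol) (U : Machine) (code : List (List Bool) ≃ List Bool)
    (s : ℝ) (D : ℕ) {n : ℕ} (x y : Fin n → Bool) (rA rB : Fin (P.coins n) → Bool) : Prop :=
  ∃ z : List Bool, P.answerA x y rA rB = z ∧ P.answerB x y rA rB = z ∧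
    s ≤ (z.length : ℝ) ∧
    z.length ≤ condK U z
      (code (P.transcript x y rA rB :: complexityProfile U code (List.ofFn x) (List.ofFn y))) + D

end Protocol

/-! Only the first `s = n / 2 ^ β` bits of the inputs are used, where `(1 / 2) ^ β` equals `δ` up to
a factor of two. Alice multiplies the number `u` of her prefix by a random seed `a` modulo a prime
between `2 ^ s` and `2 ^ (s + 1)`. She sends the seed and the top `s / 2 + o(s)` digits of the
residue; the next `s / 2 - o(s)` digits are the key, and roughly `s ^ (3 / 4)` lowest digits are
discarded. Bob looks for a string that is close to his own prefix and has the received hash value.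

Agreement. Since `h(θ) = 1 / 2`, a Hamming ball of radius `θ s` has about `2 ^ (s / 2)` points, so
slightly more than `s / 2` hash digits single out `u` among them for most seeds
(`card_hash_collision_le`, `card_false_candidate_le`). The prefixes may be at a larger distance than
`θ s`, but not by much: by an exponential moment bound, few words at distance about `θ n` from `y`
have an excess of differences in the prefix, and listing these words would give `C(x | y) ≤ n / 2 -
κ √s + O(log n)`, against the profile (`Machine.IsOptimal.ballCount_le_or_condK_le`).

Secrecy. Suppose that at least a thousandth of the seeds give a key that the transcript and the
profile compress by more than 24 bits. The transcript depends on `x` only through the seed and the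
digits sent, so for each seed such keys, taken with the digits sent, form a set of at most `2 ^ (s -
slack s - 24)` values. A second moment count over the hash family shows that at most `2 ^ (n - slack
s)` strings of length `n` hit these sets for so many seeds (`card_le_of_longHash_mem`). They can be
enumerated from `n` and the profile, hence `C(x) ≤ n - slack s + O(log n)`. Symmetry of information
(`Machine.IsOptimal.plainK_add_condK_le`) turns the profile into `C(x) ≥ n - O(log n)`, and `slack
s` outgrows every multiple of `log n`. The count compresses the whole of `x`, so nothing about the
complexity of its prefix is needed. -/

/-! ### Binary notation of fixed width -/

/-- The `w` lowest binary digits of `a`, the lowest one first. -/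
def bitsOf (w a : ℕ) : List Bool :=
  (List.range w).map fun i => decide (a / 2 ^ i % 2 = 1)

/-- The number with the binary digits `l`, the lowest one first. -/
def numOf (l : List Bool) : ℕ :=
  l.foldr (fun b n => b.toNat + 2 * n) 0

@[simp] theorem length_bitsOf (w a : ℕ) : (bitsOf w a).length = w := by
  simp [bitsOf]

@[simp] theorem bitsOf_zero (a : ℕ) : bitsOf 0 a = [] := rfl

theorem bitsOf_succ (w a : ℕ) : bitsOf (w + 1) a = decide (a % 2 = 1) :: bitsOf w (a / 2) := by
  simp [bitsOf, List.range_succ_eq_map, Function.comp_def, Nat.div_div_eq_div_mul, pow_succ']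

@[simp] theorem numOf_nil : numOf [] = 0 := rfl

@[simp] theorem numOf_cons (b : Bool) (l : List Bool) : numOf (b :: l) = b.toNat + 2 * numOf l :=
  rfl

theorem numOf_lt (l : List Bool) : numOf l < 2 ^ l.length := by
  induction l with
  | nil => simp
  | cons b l ih =>
    have := Bool.toNat_le b
    simp only [numOf_cons, List.length_cons, pow_succ]
    omega

theorem numOf_bitsOf {w a : ℕ} (h : a < 2 ^ w) : numOf (bitsOf w a) = a := by
  induction w generalizing a with
  | zero => simp at h; simp [h]
  | succ w ih =>
    rw [bitsOf_succ, numOf_cons, ih (by rw [pow_succ] at h; omega)]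
    rcases Nat.mod_two_eq_zero_or_one a with h0 | h0 <;> simp [h0] <;> omega

theorem bitsOf_numOf (l : List Bool) : bitsOf l.length (numOf l) = l := by
  induction l with
  | nil => rfl
  | cons b l ih =>
    rw [List.length_cons, bitsOf_succ, numOf_cons]
    have h : (b.toNat + 2 * numOf l) / 2 = numOf l := by
      have := Bool.toNat_lt b; omega
    rw [h, ih]
    cases b <;> simp [Nat.add_mod]

theorem numOf_injective {l l' : List Bool} (h : l.length = l'.length) (hn : numOf l = numOf l') :
    l = l' := by
  rw [← bitsOf_numOf l, ← bitsOf_numOf l', h, hn]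

theorem bitsOf_injective {w a b : ℕ} (ha : a < 2 ^ w) (hb : b < 2 ^ w)
    (h : bitsOf w a = bitsOf w b) : a = b := by
  rw [← numOf_bitsOf ha, ← numOf_bitsOf hb, h]

/-! ### Primitive recursive functions -/

theorem Primrec.nat_pow : Primrec₂ ((· ^ ·) : ℕ → ℕ → ℕ) :=
  Primrec₂.unpaired'.1 Nat.Primrec.pow

theorem Primrec.nat_count {α : Type*} [Primcodable α] {R : α → ℕ → Prop} [DecidableRel R]
    (hR : PrimrecRel R) : Primrec₂ fun (a : α) (n : ℕ) => Nat.count (R a) n := by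
  have h := Primrec.nat_rec (f := fun _ : α => 0)
    (g := fun a v => v.2 + if R a v.1 then 1 else 0) (Primrec.const 0)
    (Primrec.nat_add.comp (Primrec.snd.comp Primrec.snd)
      (Primrec.ite (hR.comp Primrec.fst (Primrec.fst.comp Primrec.snd)) (Primrec.const 1)
        (Primrec.const 0)))
  refine h.of_eq fun a n => ?_
  induction n with
  | zero => simp
  | succ n ih => simp only [Nat.count_succ, ← ih]

theorem PrimrecRel.exists_lt_nat {α : Type*} [Primcodable α] {R : α → ℕ → Prop}
    (hR : PrimrecRel R) : PrimrecRel fun (a : α) (n : ℕ) => ∃ i < n, R a i := by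
  classical
  refine PrimrecRel.of_eq (PrimrecRel.comp₂ Primrec.nat_lt (Primrec₂.const 0)
    (Primrec.nat_count hR)) fun a n => ?_
  rw [Nat.count_eq_card_filter_range, Finset.card_pos]
  simp [Finset.Nonempty]

theorem Primrec.bitsOf : Primrec₂ bitsOf := by
  refine Primrec.list_map (f := fun v : ℕ × ℕ => List.range v.1)
    (g := fun v i => decide (v.2 / 2 ^ i % 2 = 1)) (Primrec.list_range.comp Primrec.fst) ?_
  exact (PrimrecRel.comp Primrec.eq (Primrec.nat_mod.comp (Primrec.nat_div.comp
    (Primrec.snd.comp Primrec.fst) (Primrec.nat_pow.comp (Primrec.const 2) Primrec.snd))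
    (Primrec.const 2)) (Primrec.const 1)).decide

theorem Primrec.numOf : Primrec numOf := by
  refine Primrec.list_foldr (f := fun l : List Bool => l) (g := fun _ => 0)
    (h := fun _ (v : Bool × ℕ) => v.1.toNat + 2 * v.2) Primrec.id (Primrec.const 0) ?_
  exact Primrec.nat_add.comp ((Primrec.dom_bool Bool.toNat).comp (Primrec.fst.comp Primrec.snd))
    (Primrec.nat_mul.comp (Primrec.const 2) (Primrec.snd.comp Primrec.snd))

theorem PrimrecPred.nat_prime : PrimrecPred Nat.Prime := by
  have h : PrimrecPred fun p : ℕ => 2 ≤ p ∧ ∀ m < p, p % m = 0 → m = 1 := by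
    refine PrimrecPred.and (PrimrecRel.comp Primrec.nat_le (Primrec.const 2) Primrec.id) ?_
    have : PrimrecRel fun m p : ℕ => p % m = 0 → m = 1 := by
      have h1 : PrimrecRel fun m p : ℕ => ¬ (p % m = 0) ∨ m = 1 :=
        PrimrecPred.or (PrimrecPred.not (PrimrecRel.comp Primrec.eq
          (Primrec.nat_mod.comp Primrec.snd Primrec.fst) (Primrec.const 0)))
          (PrimrecRel.comp Primrec.eq Primrec.fst (Primrec.const 1))
      exact h1.of_eq fun a b => by tauto
    exact (PrimrecRel.forall_lt this).comp Primrec.id Primrec.id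
  refine h.of_eq fun p => ?_
  rw [Nat.prime_def_lt]
  simp only [Nat.dvd_iff_mod_eq_zero]

/-! ### Hamming distance of strings -/

/-- The number of positions at which `l` differs from `l'`. -/
def listDist (l l' : List Bool) : ℕ :=
  Nat.count (fun i => l.getD i false ≠ l'.getD i false) l.length

theorem Primrec.listDist : Primrec₂ listDist := by
  have h : PrimrecRel fun (v : List Bool × List Bool) (i : ℕ) =>
      v.1.getD i false ≠ v.2.getD i false :=
    PrimrecPred.not (PrimrecRel.comp Primrec.eq
      ((Primrec.list_getD false).comp (Primrec.fst.comp Primrec.fst) Primrec.snd)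
      ((Primrec.list_getD false).comp (Primrec.snd.comp Primrec.fst) Primrec.snd))
  exact (Primrec.nat_count h).comp Primrec.id (Primrec.list_length.comp Primrec.fst)

/-! ### Kolmogorov complexity: programs and enumerations -/

theorem Machine.complexity_le {M : Machine} {p x y : List Bool} (h : x ∈ M p y) :
    M.complexity x y ≤ p.length :=
  iInf₂_le p h

theorem condK_le_length_of_mem {U : Machine} {p x y : List Bool} (h : x ∈ U p y) :
    condK U x y ≤ p.length :=
  ENat.toNat_le_of_le_natCast (Machine.complexity_le h)

namespace Machine.IsOptimal

variable {U : Machine}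

theorem condK_le (hU : U.IsOptimal) {M : Machine} (hM : Partrec₂ M) :
    ∃ c : ℕ, ∀ p x y : List Bool, x ∈ M p y → condK U x y ≤ p.length + c := by
  obtain ⟨c, hc⟩ := hU.2 M hM
  refine ⟨c, fun p x y h => ENat.toNat_le_of_le_natCast ((hc x y).trans ?_)⟩
  push_cast
  gcongr
  exact Machine.complexity_le h

theorem complexity_le_length (hU : U.IsOptimal) :
    ∃ c : ℕ, ∀ x y : List Bool, U.complexity x y ≤ ((x.length + c : ℕ) : ℕ∞) := by
  have hM : Partrec₂ (fun p _ => Part.some p : Machine) :=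
    Computable₂.partrec₂ (f := fun p _ : List Bool => p) Computable.fst
  obtain ⟨c, hc⟩ := hU.2 _ hM
  refine ⟨c, fun x y => (hc x y).trans ?_⟩
  push_cast
  gcongr
  exact Machine.complexity_le (Part.mem_some x)

theorem condK_le_length (hU : U.IsOptimal) :
    ∃ c : ℕ, ∀ x y : List Bool, condK U x y ≤ x.length + c := by
  obtain ⟨c, hc⟩ := hU.complexity_le_length
  exact ⟨c, fun x y => ENat.toNat_le_of_le_natCast (hc x y)⟩

theorem exists_program (hU : U.IsOptimal) (x y : List Bool) :
    ∃ p : List Bool, x ∈ U p y ∧ p.length = condK U x y := by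
  obtain ⟨c, hc⟩ := hU.complexity_le_length
  have hne : U.complexity x y ≠ ⊤ := ne_top_of_le_ne_top (ENat.natCast_ne_top _) (hc x y)
  have hlt : U.complexity x y < ((condK U x y + 1 : ℕ) : ℕ∞) := by
    rw [← ENat.natCast_toNat hne]
    exact_mod_cast Nat.lt_succ_self _
  unfold Machine.complexity at hlt
  obtain ⟨p, hp⟩ := iInf_lt_iff.1 hlt
  obtain ⟨hm, hp⟩ := iInf_lt_iff.1 hp
  refine ⟨p, hm, le_antisymm ?_ (condK_le_length_of_mem hm)⟩
  exact Nat.lt_succ_iff.1 (by exact_mod_cast hp)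

end Machine.IsOptimal

/-- The string number `N` in an enumeration of all strings that repeats every string infinitely
often. -/
def nthString (N : ℕ) : List Bool :=
  bitsOf N.unpair.1.unpair.1 N.unpair.1.unpair.2

/-- The distinct strings `x` for which `D x k` is found to hold within `N` steps, in the order of
their discovery. -/
def enumList (D : List Bool → ℕ → Bool) (N : ℕ) : List (List Bool) :=
  Nat.rec [] (fun m L => bif D (nthString m) m.unpair.2 && !decide (∃ a ∈ L, a = nthString m)
    then L ++ [nthString m] else L) N

section EnumList

variable (D : List Bool → ℕ → Bool)

theorem enumList_succ (N : ℕ) : enumList D (N + 1) =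
    bif D (nthString N) N.unpair.2 && !decide (∃ a ∈ enumList D N, a = nthString N)
    then enumList D N ++ [nthString N] else enumList D N := rfl

theorem nodup_enumList (N : ℕ) : (enumList D N).Nodup := by
  induction N with
  | zero => exact List.nodup_nil
  | succ N ih =>
    rw [enumList_succ]
    cases h : D (nthString N) N.unpair.2 && !decide (∃ a ∈ enumList D N, a = nthString N) with
    | false => simpa using ih
    | true =>
      simp only [exists_eq_right, Bool.and_eq_true, Bool.not_eq_eq_eq_not, Bool.not_true,
        decide_eq_false_iff_not] at h
      simpa [List.nodup_append, ih] using fun a ha => ne_of_mem_of_not_mem ha h.2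

theorem exists_of_mem_enumList {N : ℕ} {x : List Bool} (hx : x ∈ enumList D N) :
    ∃ k, D x k = true := by
  induction N with
  | zero => simp [enumList] at hx
  | succ N ih =>
    rw [enumList_succ] at hx
    cases h : D (nthString N) N.unpair.2 && !decide (∃ a ∈ enumList D N, a = nthString N) with
    | false => exact ih (by simpa only [h, cond_false] using hx)
    | true =>
      simp only [h, cond_true, List.mem_append, List.mem_singleton] at hx
      rcases hx with hx | rfl
      · exact ih hx
      · exact ⟨_, (Bool.and_eq_true_iff.1 h).1⟩

/-- Strings are only appended, so the index of a discovered string is permanent and can serve as its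
description. -/
theorem enumList_prefix {M N : ℕ} (h : M ≤ N) : enumList D M <+: enumList D N := by
  induction N, h using Nat.le_induction with
  | base => exact List.prefix_rfl
  | succ N _ ih =>
    refine ih.trans ?_
    rw [enumList_succ]
    cases D (nthString N) N.unpair.2 && !decide (∃ a ∈ enumList D N, a = nthString N)
    · exact List.prefix_rfl
    · exact List.prefix_append _ _

theorem exists_mem_enumList {x : List Bool} {k : ℕ} (h : D x k = true) :
    ∃ N, x ∈ enumList D N := by
  let N := Nat.pair (Nat.pair x.length (numOf x)) k
  have hN : nthString N = x := by simp [nthString, N, bitsOf_numOf]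
  have hk : N.unpair.2 = k := by simp [N]
  refine ⟨N + 1, ?_⟩
  rw [enumList_succ, hN, hk, h]
  by_cases hx : x ∈ enumList D N <;> simp [hx]

end EnumList

theorem Computable.enumList {α : Type*} [Primcodable α] {D : α → List Bool × ℕ → Bool}
    (hD : Computable₂ D) :
    Computable₂ fun (a : α) (N : ℕ) => enumList (fun x k => D a (x, k)) N := by
  have hnth : Primrec nthString :=
    Primrec.bitsOf.comp (Primrec.fst.comp (Primrec.unpair.comp (Primrec.fst.comp Primrec.unpair)))
      (Primrec.snd.comp (Primrec.unpair.comp (Primrec.fst.comp Primrec.unpair)))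
  have hmem : Primrec₂ fun (L : List (List Bool)) (x : List Bool) => decide (∃ a ∈ L, a = x) :=
    (PrimrecRel.exists_mem_list Primrec.eq).decide
  let hm : Computable fun v : (α × ℕ) × ℕ × List (List Bool) => v.2.1 :=
    Computable.fst.comp Computable.snd
  let hL : Computable fun v : (α × ℕ) × ℕ × List (List Bool) => v.2.2 :=
    Computable.snd.comp Computable.snd
  refine Computable.nat_rec (f := fun v : α × ℕ => v.2) (g := fun _ => [])
    (h := fun v w => bif D v.1 (nthString w.1, w.1.unpair.2) &&
      !decide (∃ a ∈ w.2, a = nthString w.1) then w.2 ++ [nthString w.1] else w.2)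
    Computable.snd (Computable.const []) ?_
  refine Computable.cond ?_ (Computable.list_concat.comp hL (hnth.to_comp.comp hm)) hL
  refine Primrec.and.to_comp.comp ?_ (Primrec.not.to_comp.comp (hmem.to_comp.comp hL
    (hnth.to_comp.comp hm)))
  exact hD.comp (Computable.fst.comp Computable.fst) ((hnth.to_comp.comp hm).pair
    (Computable.snd.comp (Computable.unpair.comp hm)))

/-- A self-delimiting parameter `q`, followed by a string. -/
def withParam (q : ℕ) (l : List Bool) : List Bool :=
  List.replicate q.size true ++ false :: (bitsOf q.size q ++ l)

/-- The length of the unary prefix of a string. -/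
def unaryPrefix (p : List Bool) : ℕ := (p.takeWhile id).length

theorem unaryPrefix_withParam (q : ℕ) (l : List Bool) : unaryPrefix (withParam q l) = q.size := by
  simp [unaryPrefix, withParam]

theorem length_withParam (q : ℕ) (l : List Bool) :
    (withParam q l).length = 2 * q.size + 1 + l.length := by
  simp [withParam]; ring

theorem drop_withParam (q : ℕ) (l : List Bool) :
    (withParam q l).drop (unaryPrefix (withParam q l) + 1) = bitsOf q.size q ++ l := by
  rw [unaryPrefix_withParam, withParam, List.drop_append]
  simp

/-- Strings in a small set that is enumerable from a parameter `q` and a condition `y` have small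
complexity. -/
theorem Machine.IsOptimal.condK_le_of_enumerable {U : Machine} (hU : U.IsOptimal)
    {D : ℕ × List Bool → List Bool × ℕ → Bool} (hD : Computable₂ D) :
    ∃ c : ℕ, ∀ (q k : ℕ) (y x : List Bool) (S : Finset (List Bool)),
      (∀ x' N, D (q, y) (x', N) = true → x' ∈ S) → S.card ≤ 2 ^ k →
      (∃ N, D (q, y) (x, N) = true) → condK U x y ≤ k + 2 * q.size + c := by
  let par : List Bool → ℕ := fun p =>
    numOf ((p.drop (unaryPrefix p + 1)).take (unaryPrefix p))
  let idx : List Bool → ℕ := fun p =>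
    numOf ((p.drop (unaryPrefix p + 1)).drop (unaryPrefix p))
  have hu : Primrec unaryPrefix := Primrec.list_length.comp (Primrec.list_takeWhile Primrec.id)
  have hd : Primrec fun p : List Bool => p.drop (unaryPrefix p + 1) :=
    Primrec.list_drop.comp (Primrec.succ.comp hu) Primrec.id
  have hpar : Computable par := (Primrec.numOf.comp (Primrec.list_take.comp hu hd)).to_comp
  have hidx : Computable idx := (Primrec.numOf.comp (Primrec.list_drop.comp hu hd)).to_comp
  -- A program is the self-delimiting `q` followed by the index of `x` in the order of discovery.
  -- The index takes up all the remaining bits, so its width `k` need not be encoded.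
  let M : Machine := fun p y => Nat.rfindOpt fun N =>
    (enumList (fun x k => D (par p, y) (x, k)) N)[idx p]?
  have hM : Partrec₂ M := by
    refine Partrec.rfindOpt (f := fun (v : List Bool × List Bool) N =>
      (enumList (fun x k => D (par v.1, v.2) (x, k)) N)[idx v.1]?) ?_
    refine Computable.list_getElem?.comp ?_ (hidx.comp (Computable.fst.comp Computable.fst))
    exact (Computable.enumList hD).comp ((hpar.comp (Computable.fst.comp Computable.fst)).pair
      (Computable.snd.comp Computable.fst)) Computable.snd
  obtain ⟨c, hc⟩ := hU.condK_le hM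
  refine ⟨c + 1, fun q k y x S hS hcard ⟨N, hN⟩ => ?_⟩
  obtain ⟨N, hx⟩ := exists_mem_enumList (fun x k => D (q, y) (x, k)) hN
  obtain ⟨i, hi, hix⟩ := List.getElem_of_mem hx
  have hlen : (enumList (fun x k => D (q, y) (x, k)) N).length ≤ 2 ^ k := by
    rw [← List.toFinset_card_of_nodup (nodup_enumList _ _)]
    refine (Finset.card_le_card fun x' hx' => ?_).trans hcard
    obtain ⟨m, hm⟩ := exists_of_mem_enumList _ (List.mem_toFinset.1 hx')
    exact hS x' m hm
  have hpp : par (withParam q (bitsOf k i)) = q := by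
    simp only [par]
    rw [drop_withParam, unaryPrefix_withParam, List.take_left' (by simp),
      numOf_bitsOf (Nat.lt_size_self q)]
  have hii : idx (withParam q (bitsOf k i)) = i := by
    simp only [idx]
    rw [drop_withParam, unaryPrefix_withParam, List.drop_left' (by simp),
      numOf_bitsOf (hi.trans_le hlen)]
  have hmem : x ∈ M (withParam q (bitsOf k i)) y := by
    simp only [M, hpp, hii]
    refine (Nat.rfindOpt_mono ?_).2 ⟨N, ?_⟩
    · intro a m n hmn ha
      obtain ⟨t, ht⟩ := enumList_prefix (fun x k => D (q, y) (x, k)) hmn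
      rw [Option.mem_def] at ha ⊢
      rw [← ht, List.getElem?_append_left (List.getElem?_eq_some_iff.1 ha).1, ha]
    · simp [List.getElem?_eq_getElem hi, hix]
  have := hc _ x y hmem
  rw [length_withParam, length_bitsOf] at this
  omega

/-! ### Computations with a time bound -/

/-- Running a code with a step bound makes "some short program prints this" the union over `k` of
decidable events that grow with `k`, which is the form that enumerations need. -/
theorem Partrec.exists_stages {α σ : Type*} [Primcodable α] [Primcodable σ] {f : α →. σ}
    (hf : Partrec f) : ∃ e : ℕ → α → Option σ, Primrec₂ e ∧
      (∀ {m n : ℕ} {a : α} {s : σ}, m ≤ n → e m a = some s → e n a = some s) ∧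
      ∀ {a : α} {s : σ}, s ∈ f a ↔ ∃ k, e k a = some s := by
  obtain ⟨c, hc⟩ := Nat.Partrec.Code.exists_code.1 hf
  refine ⟨fun k a => (Nat.Partrec.Code.evaln k c (Encodable.encode a)).bind Encodable.decode,
    ?_, ?_, ?_⟩
  · refine Primrec.option_bind (f := fun v : ℕ × α =>
      Nat.Partrec.Code.evaln v.1 c (Encodable.encode v.2)) (g := fun _ m => Encodable.decode m)
      ?_ (Primrec.decode.comp Primrec.snd)
    exact Nat.Partrec.Code.primrec_evaln.comp
      ((Primrec.fst.pair (Primrec.const c)).pair (Primrec.encode.comp Primrec.snd))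
  · intro m n a s hmn h
    obtain ⟨v, hv, h⟩ := Option.bind_eq_some_iff.1 h
    exact Option.bind_eq_some_iff.2 ⟨v, Nat.Partrec.Code.evaln_mono hmn hv, h⟩
  · intro a s
    have h : ∀ v, v ∈ c.eval (Encodable.encode a) ↔ ∃ s ∈ f a, Encodable.encode s = v := by
      intro v; simp [hc]
    constructor
    · intro hs
      obtain ⟨k, hk⟩ := Nat.Partrec.Code.evaln_complete.1 ((h _).2 ⟨s, hs, rfl⟩)
      exact ⟨k, Option.bind_eq_some_iff.2 ⟨_, hk, by simp⟩⟩
    · rintro ⟨k, hk⟩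
      obtain ⟨v, hv, hk⟩ := Option.bind_eq_some_iff.1 hk
      obtain ⟨s', hs', rfl⟩ := (h v).1 (Nat.Partrec.Code.evaln_complete.2 ⟨k, hv⟩)
      rw [Encodable.encodek] at hk
      exact (Option.some_inj.1 hk) ▸ hs'

/-- Finitely many events that each occur at some stage and persist have all occurred by the latest
of these stages. This makes "at least `K` indices succeed" enumerable. -/
theorem exists_le_count_of_monotone {R : ℕ → ℕ → Prop} [DecidableRel R]
    (hR : ∀ i m n, m ≤ n → R m i → R n i) {n K : ℕ} (s : Finset ℕ) (hs : s ⊆ Finset.range n)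
    (hK : K ≤ s.card) (h : ∀ i ∈ s, ∃ N, R N i) : ∃ N, K ≤ Nat.count (R N) n := by
  choose! g hg using h
  refine ⟨s.sup g, ?_⟩
  rw [Nat.count_eq_card_filter_range]
  refine hK.trans (Finset.card_le_card fun i hi => ?_)
  exact Finset.mem_filter.2 ⟨hs hi, hR i _ _ (Finset.le_sup hi) (hg i hi)⟩

/-! ### Enumeration of programs -/

/-- An enumeration of all strings; those of length less than `l` are among the first `2 ^ l`. -/
def nthProg (i : ℕ) : List Bool :=
  bitsOf (Nat.findGreatest (fun w => 2 ^ w ≤ i) i) i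

theorem Primrec.nthProg : Primrec nthProg := by
  refine Primrec.bitsOf.comp (Primrec.nat_findGreatest (p := fun i w => 2 ^ w ≤ i) Primrec.id
    (PrimrecRel.comp Primrec.nat_le (Primrec.nat_pow.comp (Primrec.const 2) Primrec.snd)
      Primrec.fst)) Primrec.id

theorem bitsOf_add_two_pow (w a : ℕ) : bitsOf w (a + 2 ^ w) = bitsOf w a := by
  induction w generalizing a with
  | zero => rfl
  | succ w ih =>
    have h1 : (a + 2 ^ (w + 1)) % 2 = a % 2 := by rw [pow_succ]; omega
    have h2 : (a + 2 ^ (w + 1)) / 2 = a / 2 + 2 ^ w := by rw [pow_succ]; omega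
    rw [bitsOf_succ, bitsOf_succ, h1, h2, ih]

/-- Put a leading digit 1 on top of the binary digits of `p`: its position, recovered by
`Nat.findGreatest`, marks the length of `p`. -/
theorem exists_nthProg_eq {p : List Bool} {l : ℕ} (h : p.length < l) :
    ∃ i < 2 ^ l, nthProg i = p := by
  have hlt := numOf_lt p
  refine ⟨numOf p + 2 ^ p.length, ?_, ?_⟩
  · calc numOf p + 2 ^ p.length < 2 ^ p.length + 2 ^ p.length := by omega
      _ = 2 ^ (p.length + 1) := by ring
      _ ≤ 2 ^ l := Nat.pow_le_pow_right (by norm_num) h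
  · have : Nat.findGreatest (fun w => 2 ^ w ≤ numOf p + 2 ^ p.length)
        (numOf p + 2 ^ p.length) = p.length := by
      rw [Nat.findGreatest_eq_iff]
      refine ⟨(Nat.lt_two_pow_self).le.trans (Nat.le_add_left _ _),
        fun _ => Nat.le_add_left _ _, fun m hm _ hle => ?_⟩
      have : 2 ^ (p.length + 1) ≤ 2 ^ m := Nat.pow_le_pow_right (by norm_num) hm
      rw [pow_succ] at this
      omega
    rw [nthProg, this, bitsOf_add_two_pow, bitsOf_numOf]

theorem Nat.size_pair_le {a b s : ℕ} (ha : a.size ≤ s) (hb : b.size ≤ s) :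
    (Nat.pair a b).size ≤ 2 * s := by
  rw [Nat.size_le] at *
  refine (Nat.pair_lt_max_add_one_sq a b).trans_le ?_
  rw [mul_comm, pow_mul]
  exact Nat.pow_le_pow_left (by omega) 2

/-! ### Symmetry of information -/

/-- The difficult half of the Kolmogorov–Levin theorem. -/
theorem Machine.IsOptimal.plainK_add_condK_le {U : Machine} (hU : U.IsOptimal)
    {code : List (List Bool) ≃ List Bool} (hcode : code.Computable) :
    ∃ c : ℕ, ∀ x y : List Bool,
      plainK U y + condK U x y ≤ tupleK U code [x, y] + c * (tupleK U code [x, y] + 1).size + c := by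
  classical
  let f : List Bool →. List (List Bool) := fun p => (U p []).map code.symm
  have hf : Partrec f := (hU.1.comp Computable.id (Computable.const [])).map
    (hcode.2.comp Computable.snd)
  obtain ⟨e, he, hmono, hef⟩ := hf.exists_stages
  -- A program that does not halt gets the default `[]`. Its length is not 2, so such a program
  -- never counts as printing a pair.
  let out : ℕ → List (List Bool) := fun i => (f (nthProg i)).toOption.getD []
  have hout : ∀ {i ts}, ts ∈ f (nthProg i) → out i = ts := by
    intro i ts h
    simp [out, Part.mem_toOption.2 h |> Option.mem_def.1]
  -- the strings whose pair with `y` is printed by a short program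
  have hprog : Primrec fun v : (ℕ × ℕ) => e v.1 (nthProg v.2) :=
    he.comp Primrec.fst (Primrec.nthProg.comp Primrec.snd)
  let R₁ : ((ℕ × List Bool) × (List Bool × ℕ)) → ℕ → Prop := fun v i =>
    e v.2.2 (nthProg i) = some [v.2.1, v.1.2]
  have hR₁ : PrimrecRel R₁ := by
    change PrimrecPred fun w : ((ℕ × List Bool) × (List Bool × ℕ)) × ℕ =>
      e w.1.2.2 (nthProg w.2) = some [w.1.2.1, w.1.1.2]
    refine PrimrecRel.comp Primrec.eq (hprog.comp ((Primrec.snd.comp (Primrec.snd.comp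
      Primrec.fst)).pair Primrec.snd)) (Primrec.option_some.comp ?_)
    exact Primrec.list_cons.comp (Primrec.fst.comp (Primrec.snd.comp Primrec.fst))
      (Primrec.list_cons.comp (Primrec.snd.comp (Primrec.fst.comp Primrec.fst))
        (Primrec.const []))
  have hD₁ : Computable₂ fun (a : ℕ × List Bool) (b : List Bool × ℕ) =>
      decide (∃ i < 2 ^ a.1, R₁ (a, b) i) :=
    (hR₁.exists_lt_nat.comp Primrec.id (Primrec.nat_pow.comp (Primrec.const 2)
      (Primrec.fst.comp Primrec.fst))).decide.to_comp
  obtain ⟨c₁, hc₁⟩ := hU.condK_le_of_enumerable hD₁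
  -- the strings `y` that have many such partners
  let R₂ : (List Bool × ℕ) → ℕ → Prop := fun b i =>
    ((e b.2 (nthProg i)).getD []).length = 2 ∧ ((e b.2 (nthProg i)).getD []).getD 1 [] = b.1
  have hR₂ : PrimrecRel R₂ := by
    have h0 : Primrec fun v : (List Bool × ℕ) × ℕ => (e v.1.2 (nthProg v.2)).getD [] :=
      Primrec.option_getD.comp (hprog.comp ((Primrec.snd.comp Primrec.fst).pair Primrec.snd))
        (Primrec.const [])
    exact PrimrecPred.and
      (PrimrecRel.comp Primrec.eq (Primrec.list_length.comp h0) (Primrec.const 2))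
      (PrimrecRel.comp Primrec.eq ((Primrec.list_getD []).comp h0 (Primrec.const 1))
        (Primrec.fst.comp Primrec.fst))
  have hD₂ : Computable₂ fun (a : ℕ × List Bool) (b : List Bool × ℕ) =>
      decide (2 ^ a.1.unpair.2 ≤ Nat.count (R₂ b) (2 ^ a.1.unpair.1)) := by
    have hu : Primrec fun v : (ℕ × List Bool) × (List Bool × ℕ) => v.1.1.unpair :=
      Primrec.unpair.comp (Primrec.fst.comp Primrec.fst)
    exact (PrimrecRel.comp Primrec.nat_le
      (Primrec.nat_pow.comp (Primrec.const 2) (Primrec.snd.comp hu))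
      ((Primrec.nat_count hR₂).comp Primrec.snd
        (Primrec.nat_pow.comp (Primrec.const 2) (Primrec.fst.comp hu)))).decide.to_comp
  obtain ⟨c₂, hc₂⟩ := hU.condK_le_of_enumerable hD₂
  refine ⟨c₁ + c₂ + 6, fun x y => ?_⟩
  obtain ⟨p, hp, hpl⟩ := hU.exists_program (code [x, y]) []
  set T := tupleK U code [x, y] with hT
  have hpT : p.length < T + 1 := by rw [hpl, hT]; exact Nat.lt_succ_self _
  obtain ⟨i₀, hi₀, rfl⟩ := exists_nthProg_eq hpT
  have hi₀f : [x, y] ∈ f (nthProg i₀) := by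
    simpa [f] using ⟨_, hp, code.symm_apply_apply _⟩
  let Q : List Bool → ℕ → Prop := fun y' i => (out i).length = 2 ∧ (out i).getD 1 [] = y'
  let P : List Bool → Finset ℕ := fun y' => (Finset.range (2 ^ (T + 1))).filter (Q y')
  have hi₀P : i₀ ∈ P y := by
    simp only [P, Q, Finset.mem_filter, Finset.mem_range, hout hi₀f]
    exact ⟨hi₀, rfl, rfl⟩
  have hP0 : (P y).card ≠ 0 := (Finset.card_pos.2 ⟨i₀, hi₀P⟩).ne'
  -- Up to a factor of two, `2 ^ k` indices of short programs yield a pair with second entry `y`.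
  -- Given `y`, the string `x` costs about `k` bits; and `y` is one of few strings with so many
  -- indices, so it costs about `T - k` bits. In the sum `k` cancels.
  set k := Nat.log 2 (P y).card with hk
  have hk1 : 2 ^ k ≤ (P y).card := Nat.pow_log_le_self 2 hP0
  have hk2 : (P y).card ≤ 2 ^ (k + 1) := (Nat.lt_pow_succ_log_self (by norm_num) _).le
  have hkT : k ≤ T + 1 := by
    refine (Nat.pow_le_pow_iff_right (by norm_num : 1 < 2)).1 (hk1.trans ?_)
    simpa using Finset.card_filter_le (Finset.range (2 ^ (T + 1))) (Q y)
  have h1 : condK U x y ≤ (k + 1) + 2 * (T + 1).size + c₁ := by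
    refine hc₁ (T + 1) (k + 1) y x ((P y).image fun i => (out i).headI) ?_
      (Finset.card_image_le.trans hk2) ?_
    · intro x' N h
      obtain ⟨i, hi, hR⟩ := of_decide_eq_true h
      have ho := hout (hef.2 ⟨N, hR⟩)
      refine Finset.mem_image.2 ⟨i, ?_, by rw [ho]; rfl⟩
      simp only [P, Q, Finset.mem_filter, Finset.mem_range, ho]
      exact ⟨hi, rfl, rfl⟩
    · obtain ⟨N, hN⟩ := hef.1 hi₀f
      exact ⟨N, decide_eq_true ⟨i₀, hi₀, hN⟩⟩
  have h2 : condK U y [] ≤ (T + 1 - k) + 2 * (Nat.pair (T + 1) k).size + c₂ := by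
    let Y : Finset (List Bool) := ((Finset.range (2 ^ (T + 1))).image
      fun i => (out i).getD 1 []).filter fun y' => 2 ^ k ≤ (P y').card
    refine hc₂ (Nat.pair (T + 1) k) (T + 1 - k) [] y Y ?_ ?_ ?_
    · intro y' N h
      simp only [Nat.unpair_pair] at h
      have h := of_decide_eq_true h
      rw [Nat.count_eq_card_filter_range] at h
      have hsub : (Finset.range (2 ^ (T + 1))).filter (R₂ (y', N)) ⊆ P y' := by
        intro i hi
        obtain ⟨hi, hl, hy⟩ := Finset.mem_filter.1 hi
        simp only at hl hy
        obtain ⟨ts, hts⟩ : ∃ ts, e N (nthProg i) = some ts := by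
          cases hh : e N (nthProg i) with
          | none => simp [hh] at hl
          | some ts => exact ⟨ts, rfl⟩
        have ho := hout (hef.2 ⟨N, hts⟩)
        rw [hts] at hl hy
        exact Finset.mem_filter.2 ⟨hi, by rw [ho]; exact hl, by rw [ho]; exact hy⟩
      have hle := h.trans (Finset.card_le_card hsub)
      obtain ⟨i, hi⟩ := Finset.card_pos.1 ((Nat.two_pow_pos k).trans_le hle)
      obtain ⟨hi, _, hy⟩ := Finset.mem_filter.1 hi
      exact Finset.mem_filter.2 ⟨Finset.mem_image.2 ⟨i, hi, hy⟩, hle⟩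
    -- The sets `P y'` for `y' ∈ Y` are disjoint and have at least `2 ^ k` elements each among `2 ^
    -- (T + 1)` indices.
    · have := Finset.mul_card_image_le_card_of_maps_to
        (s := (Finset.range (2 ^ (T + 1))).filter fun i => (out i).getD 1 [] ∈ Y) (t := Y)
        (f := fun i => (out i).getD 1 []) (fun i hi => (Finset.mem_filter.1 hi).2) (2 ^ k)
        (fun y' hy' => by
          refine (Finset.mem_filter.1 hy').2.trans (Finset.card_le_card fun i hi => ?_)
          obtain ⟨hi, _, hy⟩ := Finset.mem_filter.1 hi
          exact Finset.mem_filter.2 ⟨Finset.mem_filter.2 ⟨hi, by rw [hy]; exact hy'⟩, hy⟩)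
      have h3 := this.trans (Finset.card_filter_le _ _)
      rw [Finset.card_range, ← Nat.sub_add_cancel hkT, pow_add, mul_comm] at h3
      simpa using Nat.le_of_mul_le_mul_right h3 (Nat.two_pow_pos k)
    · simp only [Nat.unpair_pair]
      obtain ⟨N, hN⟩ := exists_le_count_of_monotone (R := fun N i => R₂ (y, N) i)
        (n := 2 ^ (T + 1)) (K := 2 ^ k) (by
          intro i m n hmn ⟨hl, hy⟩
          simp only at hl hy
          obtain ⟨ts, hts⟩ : ∃ ts, e m (nthProg i) = some ts := by
            cases hh : e m (nthProg i) with
            | none => simp [hh] at hl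
            | some ts => exact ⟨ts, rfl⟩
          simp only [R₂, hmono hmn hts]
          rw [hts] at hl hy
          exact ⟨hl, hy⟩) (P y) (Finset.filter_subset _ _) hk1 (by
          intro i hi
          obtain ⟨_, hl, hy⟩ := Finset.mem_filter.1 hi
          obtain ⟨ts, hts⟩ : ∃ ts, ts ∈ f (nthProg i) := by
            by_contra hno
            push Not at hno
            have : f (nthProg i) = Part.none := Part.eq_none_iff.2 hno
            simp [out, this] at hl
          obtain ⟨N, hN⟩ := hef.1 hts
          refine ⟨N, ?_⟩
          simp only [R₂, hN]
          rw [hout hts] at hl hy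
          exact ⟨hl, hy⟩)
      exact ⟨N, decide_eq_true hN⟩
  have h3 : (Nat.pair (T + 1) k).size ≤ 2 * (T + 1).size :=
    Nat.size_pair_le le_rfl (Nat.size_le_size hkT)
  have hs : 1 ≤ (T + 1).size := Nat.size_pos.2 (Nat.succ_pos T)
  have h4 : plainK U y = condK U y [] := rfl
  rw [h4]
  have h5 : 6 * (T + 1).size ≤ (c₁ + c₂ + 6) * (T + 1).size :=
    Nat.mul_le_mul_right _ (by omega)
  generalize (c₁ + c₂ + 6) * (T + 1).size = z at *
  omega

/-! ### A family of hash functions -/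

/-- The slack in the lengths of hash values and keys, about `s ^ (3 / 4)`. -/
def slack (s : ℕ) : ℕ := s.sqrt * s.sqrt.sqrt

/-- The length of the hash value that is sent. -/
def hashLen (s : ℕ) : ℕ := s / 2 + slack s + 20

/-- The length of the secret key. -/
def keyLen (s : ℕ) : ℕ := s - hashLen s - slack s

/-- A prime number between `2 ^ s` and `2 ^ (s + 1)`. -/
def modulus (s : ℕ) : ℕ := Nat.findGreatest Nat.Prime (2 ^ (s + 1))

/-- The hash function with seed `a`. -/
def hashVal (s a u : ℕ) : ℕ := a * u % modulus s

/-- The high digits of the hash value, which are sent. -/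
def shortHash (s a u : ℕ) : ℕ := hashVal s a u / 2 ^ (s + 1 - hashLen s)

/-- All digits of the hash value except for the lowest ones. -/
def longHash (s a u : ℕ) : ℕ := hashVal s a u / 2 ^ (slack s + 1)

/-- The secret key: those digits of `longHash` that are not sent. -/
def hashKey (s a u : ℕ) : List Bool := bitsOf (keyLen s) (longHash s a u % 2 ^ keyLen s)

theorem modulus_spec (s : ℕ) : (modulus s).Prime ∧ 2 ^ s < modulus s := by
  obtain ⟨p, hp, h1, h2⟩ := Nat.exists_prime_lt_and_le_two_mul (2 ^ s) (by positivity)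
  rw [← pow_succ'] at h2
  exact ⟨Nat.findGreatest_spec h2 hp, h1.trans_le (Nat.le_findGreatest h2 hp)⟩

theorem hashVal_lt (s a u : ℕ) : hashVal s a u < 2 ^ (s + 1) :=
  (Nat.mod_lt _ (modulus_spec s).1.pos).trans_le (Nat.findGreatest_le _)

/-- The difference of two residues determines the seed, since `u - u'` is invertible modulo the
prime and the seeds are smaller than it. Values that agree above the digit `q` differ by less than
`2 ^ q` in absolute value, which leaves fewer than `2 ^ (q + 1)` differences. -/
theorem card_hash_collision_le {s u u' : ℕ} (hu : u < 2 ^ s) (hu' : u' < 2 ^ s) (hne : u ≠ u')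
    (q : ℕ) : ((Finset.range (2 ^ s)).filter fun a =>
      hashVal s a u / 2 ^ q = hashVal s a u' / 2 ^ q).card ≤ 2 ^ (q + 1) := by
  obtain ⟨hp, hlt⟩ := modulus_spec s
  have : Fact (modulus s).Prime := ⟨hp⟩
  have hcast : ∀ {a b : ℕ}, a < 2 ^ s → b < 2 ^ s → (a : ZMod (modulus s)) = b → a = b := by
    intro a b ha hb h
    rw [ZMod.natCast_eq_natCast_iff'] at h
    rwa [Nat.mod_eq_of_lt (ha.trans hlt), Nat.mod_eq_of_lt (hb.trans hlt)] at h
  have hsub : (u : ZMod (modulus s)) - u' ≠ 0 := fun h => hne (hcast hu hu' (sub_eq_zero.1 h))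
  have hclose : ∀ {v w : ℕ}, v / 2 ^ q = w / 2 ^ q → w < v + 2 ^ q := by
    intro v w h
    have hpos := Nat.two_pow_pos q
    have h1 := Nat.div_add_mod w (2 ^ q)
    have h2 := Nat.div_mul_le_self v (2 ^ q)
    have h3 := Nat.mod_lt w hpos
    rw [← h, mul_comm] at h1
    omega
  rw [← Finset.card_range (2 ^ (q + 1))]
  -- The shift by `2 ^ q` keeps the difference of colliding residues positive, so subtraction of
  -- natural numbers does not truncate.
  refine Finset.card_le_card_of_injOn (fun a => hashVal s a u + 2 ^ q - hashVal s a u') ?_ ?_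
  · intro a ha
    have h := (Finset.mem_filter.1 ha).2
    have h1 := hclose h
    have h2 := hclose h.symm
    refine Finset.mem_coe.2 (Finset.mem_range.2 ?_)
    simp only [pow_succ]
    omega
  · intro a ha b hb hab
    obtain ⟨ha, hac⟩ := Finset.mem_filter.1 ha
    obtain ⟨hb, hbc⟩ := Finset.mem_filter.1 hb
    have h1 := hclose hac
    have h2 := hclose hbc
    have h : hashVal s a u + hashVal s b u' = hashVal s b u + hashVal s a u' := by
      simp only at hab; omega
    have h' := congrArg (Nat.cast : ℕ → ZMod (modulus s)) h
    simp only [hashVal, Nat.cast_add, ZMod.natCast_mod, Nat.cast_mul] at h'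
    have h'' : ((a : ZMod (modulus s)) - b) * ((u : ZMod (modulus s)) - u') = 0 := by
      linear_combination h'
    exact hcast (Finset.mem_range.1 ha) (Finset.mem_range.1 hb)
      (sub_eq_zero.1 ((mul_eq_zero.1 h'').resolve_right hsub))

theorem hashLen_add_keyLen_add {s : ℕ} (h : 0 < keyLen s) :
    hashLen s + keyLen s + slack s = s := by
  unfold keyLen at *; omega

theorem longHash_div {s : ℕ} (h : 0 < keyLen s) (a u : ℕ) :
    longHash s a u / 2 ^ keyLen s = shortHash s a u := by
  have := hashLen_add_keyLen_add h
  rw [longHash, shortHash, Nat.div_div_eq_div_mul, ← pow_add]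
  congr 2
  omega

theorem shortHash_lt {s : ℕ} (h : 0 < keyLen s) (a u : ℕ) :
    shortHash s a u < 2 ^ hashLen s := by
  have h1 := hashLen_add_keyLen_add h
  rw [shortHash, Nat.div_lt_iff_lt_mul (Nat.two_pow_pos _), ← pow_add,
    Nat.add_sub_cancel' (by omega)]
  exact hashVal_lt s a u

theorem shortHash_lt_two_pow {s : ℕ} (h : 0 < keyLen s) (a u : ℕ) :
    shortHash s a u < 2 ^ s :=
  (shortHash_lt h a u).trans_le (Nat.pow_le_pow_right (by norm_num)
    (by have := hashLen_add_keyLen_add h; omega))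

/-! ### Search for the string of the other party -/

/-- The number of strings of length `s` that are at least as close to `y` as the string
number `u`. -/
def ballCount (s : ℕ) (y : List Bool) (u : ℕ) : ℕ :=
  Nat.count (fun v => listDist (bitsOf s v) y ≤ listDist (bitsOf s u) y) (2 ^ s)

/-- The string number `u` is close to `y` and has the hash value `h`. -/
def IsCandidate (s : ℕ) (y : List Bool) (a : ℕ) (h : List Bool) (u : ℕ) : Prop :=
  ballCount s y u ≤ 2 ^ (s / 2 + slack s) ∧ bitsOf s (shortHash s a u) = h

instance (s : ℕ) (y : List Bool) (a : ℕ) (h : List Bool) : DecidablePred (IsCandidate s y a h) :=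
  fun _ => inferInstanceAs (Decidable (_ ∧ _))

/-- The last candidate. -/
def candidate (s : ℕ) (y : List Bool) (a : ℕ) (h : List Bool) : ℕ :=
  Nat.findGreatest (IsCandidate s y a h) (2 ^ s - 1)

/-- Whether there is a candidate. -/
def candidateExists (s : ℕ) (y : List Bool) (a : ℕ) (h : List Bool) : Bool :=
  decide (IsCandidate s y a h (candidate s y a h))

theorem candidate_lt (s : ℕ) (y : List Bool) (a : ℕ) (h : List Bool) :
    candidate s y a h < 2 ^ s := by
  have h1 : candidate s y a h ≤ 2 ^ s - 1 := Nat.findGreatest_le _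
  have h2 := Nat.two_pow_pos s
  omega

theorem candidateExists_eq_true {s : ℕ} {y : List Bool} {a : ℕ} {h : List Bool} {u : ℕ}
    (hu : u < 2 ^ s) (hc : IsCandidate s y a h u) : candidateExists s y a h = true :=
  decide_eq_true (Nat.findGreatest_spec (Nat.le_sub_one_of_lt hu) hc)

/-- The whole set lies in the ball through its farthest element, and this ball has at most `m`
points. Defining closeness by the size of the ball spares Bob any computation with `θ`. -/
theorem card_near_le (s : ℕ) (y : List Bool) (m : ℕ) :
    ((Finset.range (2 ^ s)).filter fun u => ballCount s y u ≤ m).card ≤ m := by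
  rcases Finset.eq_empty_or_nonempty
    ((Finset.range (2 ^ s)).filter fun u => ballCount s y u ≤ m) with h | h
  · simp [h]
  · obtain ⟨u, hu, hmax⟩ := Finset.exists_max_image _ (fun u => listDist (bitsOf s u) y) h
    refine le_trans ?_ (Finset.mem_filter.1 hu).2
    rw [ballCount, Nat.count_eq_card_filter_range]
    refine Finset.card_le_card fun v hv => ?_
    exact Finset.mem_filter.2 ⟨(Finset.mem_filter.1 hv).1, hmax v hv⟩

/-- With a random seed, the string `u` is the only possible candidate with its hash value, up to
a small probability of error. -/
theorem card_false_candidate_le {s : ℕ} (hs : 0 < keyLen s) (y : List Bool) {u : ℕ}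
    (hu : u < 2 ^ s) :
    2 ^ 18 * ((Finset.range (2 ^ s)).filter fun a =>
      ∃ v < 2 ^ s, v ≠ u ∧ IsCandidate s y a (bitsOf s (shortHash s a u)) v).card ≤ 2 ^ s := by
  have h1 := hashLen_add_keyLen_add hs
  set near := (Finset.range (2 ^ s)).filter fun v => ballCount s y v ≤ 2 ^ (s / 2 + slack s)
  have hsub : ((Finset.range (2 ^ s)).filter fun a =>
      ∃ v < 2 ^ s, v ≠ u ∧ IsCandidate s y a (bitsOf s (shortHash s a u)) v) ⊆
      (near.erase u).biUnion fun v => (Finset.range (2 ^ s)).filter fun a =>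
        hashVal s a v / 2 ^ (s + 1 - hashLen s) = hashVal s a u / 2 ^ (s + 1 - hashLen s) := by
    intro a ha
    obtain ⟨ha, v, hv, hne, hn, hc⟩ := Finset.mem_filter.1 ha
    refine Finset.mem_biUnion.2 ⟨v, Finset.mem_erase.2 ⟨hne,
      Finset.mem_filter.2 ⟨Finset.mem_range.2 hv, hn⟩⟩, Finset.mem_filter.2 ⟨ha, ?_⟩⟩
    exact bitsOf_injective (shortHash_lt_two_pow hs a v) (shortHash_lt_two_pow hs a u) hc
  have hcard := (Finset.card_le_card hsub).trans (Finset.card_biUnion_le_card_mul _ _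
    (2 ^ (s + 1 - hashLen s + 1)) fun v hv => card_hash_collision_le
      (Finset.mem_range.1 (Finset.mem_filter.1 (Finset.mem_of_mem_erase hv)).1) hu
      (Finset.ne_of_mem_erase hv) _)
  have hnear : (near.erase u).card ≤ 2 ^ (s / 2 + slack s) :=
    (Finset.card_le_card (Finset.erase_subset _ _)).trans (card_near_le s y _)
  refine (Nat.mul_le_mul_left _ (hcard.trans (Nat.mul_le_mul_right _ hnear))).trans ?_
  -- The exponents are `18 + (s / 2 + slack s) + (s + 2 - hashLen s) = s`: the 20 extra digits in
  -- `hashLen` pay for the error `2 ^ (-18)` of the union bound.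
  rw [← pow_add, ← pow_add]
  refine Nat.pow_le_pow_right (by norm_num) ?_
  unfold hashLen at *
  omega

/-! ### Computability -/

theorem Primrec.slack : Primrec slack :=
  Primrec.nat_mul.comp Primrec.nat_sqrt (Primrec.nat_sqrt.comp Primrec.nat_sqrt)

theorem Primrec.hashLen : Primrec hashLen :=
  Primrec.nat_add.comp (Primrec.nat_add.comp (Primrec.nat_div.comp Primrec.id (Primrec.const 2))
    Primrec.slack) (Primrec.const 20)

theorem Primrec.keyLen : Primrec keyLen :=
  Primrec.nat_sub.comp (Primrec.nat_sub.comp Primrec.id Primrec.hashLen) Primrec.slack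

theorem Primrec.two_pow : Primrec fun n : ℕ => 2 ^ n :=
  Primrec.nat_pow.comp (Primrec.const 2) Primrec.id

theorem Primrec.modulus : Primrec modulus :=
  Primrec.nat_findGreatest (f := fun s : ℕ => 2 ^ (s + 1)) (p := fun _ p => p.Prime)
    (Primrec.two_pow.comp Primrec.succ) (PrimrecPred.nat_prime.comp Primrec.snd)

section

variable {α : Type*} [Primcodable α] {s a u : α → ℕ} {y h : α → List Bool}

theorem Primrec.hashVal (hs : Primrec s) (ha : Primrec a) (hu : Primrec u) :
    Primrec fun v => hashVal (s v) (a v) (u v) :=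
  Primrec.nat_mod.comp (Primrec.nat_mul.comp ha hu) (Primrec.modulus.comp hs)

theorem Primrec.shortHash (hs : Primrec s) (ha : Primrec a) (hu : Primrec u) :
    Primrec fun v => shortHash (s v) (a v) (u v) :=
  Primrec.nat_div.comp (Primrec.hashVal hs ha hu) (Primrec.two_pow.comp
    (Primrec.nat_sub.comp (Primrec.succ.comp hs) (Primrec.hashLen.comp hs)))

theorem Primrec.longHash (hs : Primrec s) (ha : Primrec a) (hu : Primrec u) :
    Primrec fun v => longHash (s v) (a v) (u v) :=
  Primrec.nat_div.comp (Primrec.hashVal hs ha hu) (Primrec.two_pow.comp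
    (Primrec.succ.comp (Primrec.slack.comp hs)))

theorem Primrec.hashKey (hs : Primrec s) (ha : Primrec a) (hu : Primrec u) :
    Primrec fun v => hashKey (s v) (a v) (u v) :=
  Primrec.bitsOf.comp (Primrec.keyLen.comp hs) (Primrec.nat_mod.comp
    (Primrec.longHash hs ha hu) (Primrec.two_pow.comp (Primrec.keyLen.comp hs)))

theorem Primrec.ballCount (hs : Primrec s) (hy : Primrec y) (hu : Primrec u) :
    Primrec fun v => ballCount (s v) (y v) (u v) := by
  have hR : PrimrecRel fun (w : α) (i : ℕ) =>
      _root_.listDist (_root_.bitsOf (s w) i) (y w) ≤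
        _root_.listDist (_root_.bitsOf (s w) (u w)) (y w) :=
    PrimrecRel.comp Primrec.nat_le
      (Primrec.listDist.comp (Primrec.bitsOf.comp (hs.comp Primrec.fst) Primrec.snd)
        (hy.comp Primrec.fst))
      (Primrec.listDist.comp (Primrec.bitsOf.comp (hs.comp Primrec.fst) (hu.comp Primrec.fst))
        (hy.comp Primrec.fst))
  exact (Primrec.nat_count hR).comp Primrec.id (Primrec.two_pow.comp hs)

theorem PrimrecPred.isCandidate (hs : Primrec s) (hy : Primrec y) (ha : Primrec a)
    (hh : Primrec h) (hu : Primrec u) :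
    PrimrecPred fun v => IsCandidate (s v) (y v) (a v) (h v) (u v) :=
  PrimrecPred.and
    (PrimrecRel.comp Primrec.nat_le (Primrec.ballCount hs hy hu) (Primrec.two_pow.comp
      (Primrec.nat_add.comp (Primrec.nat_div.comp hs (Primrec.const 2)) (Primrec.slack.comp hs))))
    (PrimrecRel.comp Primrec.eq (Primrec.bitsOf.comp hs (Primrec.shortHash hs ha hu)) hh)

theorem Primrec.candidate (hs : Primrec s) (hy : Primrec y) (ha : Primrec a)
    (hh : Primrec h) : Primrec fun v => candidate (s v) (y v) (a v) (h v) :=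
  Primrec.nat_findGreatest (f := fun v => 2 ^ s v - 1)
    (p := fun v u => IsCandidate (s v) (y v) (a v) (h v) u)
    (Primrec.nat_sub.comp (Primrec.two_pow.comp hs) (Primrec.const 1))
    (PrimrecPred.isCandidate (hs.comp Primrec.fst) (hy.comp Primrec.fst) (ha.comp Primrec.fst)
      (hh.comp Primrec.fst) Primrec.snd)

theorem Primrec.candidateExists (hs : Primrec s) (hy : Primrec y) (ha : Primrec a)
    (hh : Primrec h) : Primrec fun v => candidateExists (s v) (y v) (a v) (h v) :=
  (PrimrecPred.isCandidate hs hy ha hh (Primrec.candidate hs hy ha hh)).decide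

end

/-! ### The protocol -/

/-- Only the first `n / 2 ^ β` bits of the inputs of length `n` are used. Alice sends a random
seed and a hash value, Bob reports whether he has found a candidate for Alice's string. -/
def keyRules (β : ℕ) : ProtocolRules where
  coins n := n / 2 ^ β
  turn n t := if t.length < 2 * (n / 2 ^ β) then some true
    else if t.length < 3 * (n / 2 ^ β) then some false else none
  bitA v := (v.2.1 ++ bitsOf (v.1.length / 2 ^ β) (shortHash (v.1.length / 2 ^ β) (numOf v.2.1)
    (numOf (v.1.take (v.1.length / 2 ^ β))))).getD v.2.2.length false
  -- Bob repeats one and the same bit `s` times. The total length is then `3 * s`, which is 0 when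
  -- `s = 0`: a bound linear in `δ n` leaves no room for an additive constant.
  bitB v := candidateExists (v.1.length / 2 ^ β) (v.1.take (v.1.length / 2 ^ β))
    (numOf (v.2.2.take (v.1.length / 2 ^ β)))
    ((v.2.2.drop (v.1.length / 2 ^ β)).take (v.1.length / 2 ^ β))
  -- Position `2 * s` holds the first of Bob's bits. If he found no candidate, both parties output
  -- the empty key and still agree.
  outA v := bif v.2.2.getD (2 * (v.1.length / 2 ^ β)) false then
    hashKey (v.1.length / 2 ^ β) (numOf v.2.1) (numOf (v.1.take (v.1.length / 2 ^ β))) else []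
  outB v := bif v.2.2.getD (2 * (v.1.length / 2 ^ β)) false then
    hashKey (v.1.length / 2 ^ β) (numOf (v.2.2.take (v.1.length / 2 ^ β)))
      (candidate (v.1.length / 2 ^ β) (v.1.take (v.1.length / 2 ^ β))
        (numOf (v.2.2.take (v.1.length / 2 ^ β)))
        ((v.2.2.drop (v.1.length / 2 ^ β)).take (v.1.length / 2 ^ β))) else []

/-- The number of the part of Alice's string that is used. -/
def usedPart (s : ℕ) (x : List Bool) : ℕ := numOf (x.take s)

section

variable {β s : ℕ} {x y : List Bool} (r t : List Bool)

theorem keyRules_bitA (hx : x.length / 2 ^ β = s) : (keyRules β).bitA (x, r, t) =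
    (r ++ bitsOf s (shortHash s (numOf r) (usedPart s x))).getD t.length false := by
  subst hx; rfl

theorem keyRules_bitB (hy : y.length / 2 ^ β = s) : (keyRules β).bitB (y, r, t) =
    candidateExists s (y.take s) (numOf (t.take s)) ((t.drop s).take s) := by
  subst hy; rfl

theorem keyRules_outA (hx : x.length / 2 ^ β = s) : (keyRules β).outA (x, r, t) =
    bif t.getD (2 * s) false then hashKey s (numOf r) (usedPart s x) else [] := by
  subst hx; rfl

theorem keyRules_outB (hy : y.length / 2 ^ β = s) : (keyRules β).outB (y, r, t) =
    bif t.getD (2 * s) false then hashKey s (numOf (t.take s))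
      (candidate s (y.take s) (numOf (t.take s)) ((t.drop s).take s)) else [] := by
  subst hy; rfl

end

/-! ### The course of the communication -/

section Transcript

variable (β : ℕ) {n : ℕ} (x y : Fin n → Bool) (rA rB : Fin ((keyRules β).coins n) → Bool)

/-- The bits sent by Alice on the seed `a`. -/
def aliceBits (s a u : ℕ) : List Bool := bitsOf s a ++ bitsOf s (shortHash s a u)

theorem length_aliceBits (s a u : ℕ) : (aliceBits s a u).length = 2 * s := by
  simp [aliceBits]; ring

/-- The answer of Bob on the seed `a`. -/
def bobAnswer (s a u : ℕ) (y : List Bool) : Bool :=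
  candidateExists s (y.take s) a (bitsOf s (shortHash s a u))

/-- All bits sent on the seed `a`. -/
def fullTranscript (s a u : ℕ) (ok : Bool) : List Bool :=
  aliceBits s a u ++ List.replicate s ok

theorem length_fullTranscript (s a u : ℕ) (ok : Bool) :
    (fullTranscript s a u ok).length = 3 * s := by
  simp [fullTranscript, length_aliceBits]; ring

theorem numOf_ofFn_lt : numOf (List.ofFn rA) < 2 ^ (n / 2 ^ β) := by
  simpa [keyRules] using numOf_lt (List.ofFn rA)

theorem bitsOf_numOf_ofFn : bitsOf (n / 2 ^ β) (numOf (List.ofFn rA)) = List.ofFn rA := by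
  have := bitsOf_numOf (List.ofFn rA)
  rwa [List.length_ofFn] at this

theorem history_keyRules {k : ℕ} (hk : k ≤ 3 * (n / 2 ^ β)) :
    (keyRules β).history x y rA rB k =
      (fullTranscript (n / 2 ^ β) (numOf (List.ofFn rA)) (usedPart (n / 2 ^ β) (List.ofFn x))
        (bobAnswer (n / 2 ^ β) (numOf (List.ofFn rA)) (usedPart (n / 2 ^ β) (List.ofFn x))
          (List.ofFn y))).take k := by
  induction k with
  | zero => simp [ProtocolRules.history]
  | succ k ih =>
    have ih := ih (by omega)
    rw [ProtocolRules.history] at ih ⊢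
    rw [Function.iterate_succ_apply', ih]
    have hr := bitsOf_numOf_ofFn β rA
    have hra := numOf_ofFn_lt β rA
    set s := n / 2 ^ β with hs
    set a := numOf (List.ofFn rA) with ha
    set u := usedPart s (List.ofFn x) with hu
    set ok := bobAnswer s a u (List.ofFn y) with hok
    set T := fullTranscript s a u ok with hT
    have hlT : T.length = 3 * s := length_fullTranscript s a u ok
    have hlen : (T.take k).length = k := by rw [List.length_take, hlT]; omega
    have hkT : k < T.length := by omega
    rw [List.take_succ_eq_append_getElem hkT]
    rcases lt_or_ge k (2 * s) with h | h
    · have hturn : (keyRules β).turn n (T.take k) = some true := by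
        simp only [keyRules, hlen]
        rw [if_pos h]
      simp only [ProtocolRules.step, hturn]
      congr 2
      have hk' : k < (aliceBits s a u).length := by rw [length_aliceBits]; exact h
      rw [keyRules_bitA (s := s) _ _ (by rw [List.length_ofFn, hs]), ← ha, ← hu, hlen, ← hr, ← aliceBits,
        List.getD_eq_getElem _ _ hk']
      simp only [hT, fullTranscript]
      rw [List.getElem_append_left hk']
    · have hturn : (keyRules β).turn n (T.take k) = some false := by
        simp only [keyRules, hlen]
        rw [if_neg (by omega), if_pos (by omega)]
      simp only [ProtocolRules.step, hturn]
      congr 2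
      have h1 : (T.take k).take s = bitsOf s a := by
        rw [List.take_take, min_eq_left (by omega), hT, fullTranscript, aliceBits,
          List.append_assoc, List.take_left' (by simp)]
      have h2 : ((T.take k).drop s).take s = bitsOf s (shortHash s a u) := by
        rw [List.drop_take, List.take_take, min_eq_left (by omega), hT, fullTranscript, aliceBits,
          List.append_assoc, List.drop_left' (by simp), List.take_left' (by simp)]
      rw [keyRules_bitB (s := s) _ _ (by rw [List.length_ofFn, hs]), h1, h2, numOf_bitsOf hra]
      simp only [hT, fullTranscript]
      rw [List.getElem_append_right (by rw [length_aliceBits]; exact h), List.getElem_replicate]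
      rfl

theorem turn_history_keyRules {k : ℕ} (hk : k ≤ 3 * (n / 2 ^ β)) :
    (keyRules β).turn n ((keyRules β).history x y rA rB k) = none ↔ k = 3 * (n / 2 ^ β) := by
  rw [history_keyRules β x y rA rB hk]
  simp only [keyRules, List.length_take, length_fullTranscript, min_eq_left hk]
  split_ifs <;> simp <;> omega

end Transcript

/-! ### Computability of the protocol, its transcript and its answers -/

section

variable (β : ℕ)

/-- The number of used bits of a string. -/
theorem Primrec.usedLength : Primrec fun x : List Bool => x.length / 2 ^ β :=
  Primrec.nat_div.comp Primrec.list_length (Primrec.const _)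

theorem primrec_bitA : Primrec (keyRules β).bitA := by
  have hs : Primrec fun v : List Bool × List Bool × List Bool => v.1.length / 2 ^ β :=
    (Primrec.usedLength β).comp Primrec.fst
  have hr : Primrec fun v : List Bool × List Bool × List Bool => v.2.1 :=
    Primrec.fst.comp Primrec.snd
  exact (Primrec.list_getD false).comp (Primrec.list_append.comp hr (Primrec.bitsOf.comp hs
    (Primrec.shortHash hs (Primrec.numOf.comp hr)
      (Primrec.numOf.comp (Primrec.list_take.comp hs Primrec.fst)))))
    (Primrec.list_length.comp (Primrec.snd.comp Primrec.snd))

theorem primrec_outA : Primrec (keyRules β).outA := by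
  have hs : Primrec fun v : List Bool × List Bool × List Bool => v.1.length / 2 ^ β :=
    (Primrec.usedLength β).comp Primrec.fst
  have hr : Primrec fun v : List Bool × List Bool × List Bool => v.2.1 :=
    Primrec.fst.comp Primrec.snd
  exact Primrec.cond ((Primrec.list_getD false).comp (Primrec.snd.comp Primrec.snd)
    (Primrec.nat_mul.comp (Primrec.const 2) hs))
    (Primrec.hashKey hs (Primrec.numOf.comp hr)
      (Primrec.numOf.comp (Primrec.list_take.comp hs Primrec.fst))) (Primrec.const [])

theorem primrec_bitB : Primrec (keyRules β).bitB := by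
  have hs : Primrec fun v : List Bool × List Bool × List Bool => v.1.length / 2 ^ β :=
    (Primrec.usedLength β).comp Primrec.fst
  have ht : Primrec fun v : List Bool × List Bool × List Bool => v.2.2 :=
    Primrec.snd.comp Primrec.snd
  exact Primrec.candidateExists hs (Primrec.list_take.comp hs Primrec.fst)
    (Primrec.numOf.comp (Primrec.list_take.comp hs ht))
    (Primrec.list_take.comp hs (Primrec.list_drop.comp hs ht))

theorem primrec_outB : Primrec (keyRules β).outB := by
  have hs : Primrec fun v : List Bool × List Bool × List Bool => v.1.length / 2 ^ β :=
    (Primrec.usedLength β).comp Primrec.fst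
  have ht : Primrec fun v : List Bool × List Bool × List Bool => v.2.2 :=
    Primrec.snd.comp Primrec.snd
  have ha := Primrec.numOf.comp (Primrec.list_take.comp hs ht)
  exact Primrec.cond ((Primrec.list_getD false).comp ht
    (Primrec.nat_mul.comp (Primrec.const 2) hs))
    (Primrec.hashKey hs ha (Primrec.candidate hs (Primrec.list_take.comp hs Primrec.fst) ha
      (Primrec.list_take.comp hs (Primrec.list_drop.comp hs ht)))) (Primrec.const [])

theorem primrec_turn : Primrec₂ (keyRules β).turn := by
  have hs : Primrec fun v : ℕ × List Bool => v.1 / 2 ^ β :=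
    Primrec.nat_div.comp Primrec.fst (Primrec.const _)
  have hl : Primrec fun v : ℕ × List Bool => v.2.length := Primrec.list_length.comp Primrec.snd
  exact Primrec.ite (PrimrecRel.comp Primrec.nat_lt hl (Primrec.nat_mul.comp (Primrec.const 2) hs))
    (Primrec.const _) (Primrec.ite (PrimrecRel.comp Primrec.nat_lt hl
      (Primrec.nat_mul.comp (Primrec.const 3) hs)) (Primrec.const _) (Primrec.const _))

/-- The protocol with the rules `keyRules β`. -/
def keyProtocol : Protocol where
  toProtocolRules := keyRules β
  coins_computable := (Primrec.nat_div.comp Primrec.id (Primrec.const _)).to_comp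
  turn_computable := (primrec_turn β).to_comp
  bitA_computable := (primrec_bitA β).to_comp
  bitB_computable := (primrec_bitB β).to_comp
  outA_computable := (primrec_outA β).to_comp
  outB_computable := (primrec_outB β).to_comp
  halts n x y rA rB := ⟨3 * (n / 2 ^ β), (turn_history_keyRules β x y rA rB le_rfl).2 rfl⟩

variable {n : ℕ} (x y : Fin n → Bool) (rA rB : Fin ((keyProtocol β).coins n) → Bool)

theorem transcript_keyProtocol : (keyProtocol β).transcript x y rA rB =
    fullTranscript (n / 2 ^ β) (numOf (List.ofFn rA)) (usedPart (n / 2 ^ β) (List.ofFn x))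
      (bobAnswer (n / 2 ^ β) (numOf (List.ofFn rA)) (usedPart (n / 2 ^ β) (List.ofFn x))
        (List.ofFn y)) := by
  have hfind : Nat.find ((keyProtocol β).halts n x y rA rB) = 3 * (n / 2 ^ β) := by
    rw [Nat.find_eq_iff]
    exact ⟨(turn_history_keyRules β x y rA rB le_rfl).2 rfl, fun m hm h =>
      hm.ne ((turn_history_keyRules β x y rA rB hm.le).1 h)⟩
  rw [Protocol.transcript, hfind]
  refine (history_keyRules β x y rA rB le_rfl).trans (List.take_of_length_le ?_)
  rw [length_fullTranscript]

theorem commComplexity_keyProtocol_le (n : ℕ) :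
    (keyProtocol β).commComplexity n ≤ 3 * (n / 2 ^ β) := by
  refine Finset.sup_le fun w _ => ?_
  rw [transcript_keyProtocol, length_fullTranscript]

theorem getD_fullTranscript {s a u : ℕ} {ok : Bool} (hs : 0 < s) :
    (fullTranscript s a u ok).getD (2 * s) false = ok := by
  rw [fullTranscript, List.getD_append_right _ _ _ _ (by rw [length_aliceBits]), length_aliceBits]
  simp [hs]

theorem keyLen_zero : keyLen 0 = 0 := by
  unfold keyLen; omega

/-- The answers of Alice and Bob, when a key of positive length is agreed upon. -/
theorem answerA_keyProtocol (hk : 0 < keyLen (n / 2 ^ β)) :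
    (keyProtocol β).answerA x y rA rB =
      bif bobAnswer (n / 2 ^ β) (numOf (List.ofFn rA)) (usedPart (n / 2 ^ β) (List.ofFn x))
        (List.ofFn y) then
      hashKey (n / 2 ^ β) (numOf (List.ofFn rA)) (usedPart (n / 2 ^ β) (List.ofFn x)) else [] := by
  have hs : 0 < n / 2 ^ β := by
    rcases Nat.eq_zero_or_pos (n / 2 ^ β) with h | h
    · rw [h, keyLen_zero] at hk; omega
    · exact h
  rw [Protocol.answerA, transcript_keyProtocol]
  change (keyRules β).outA _ = _
  rw [keyRules_outA _ _ (by rw [List.length_ofFn]), getD_fullTranscript hs]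

theorem answerB_keyProtocol (hk : 0 < keyLen (n / 2 ^ β)) :
    (keyProtocol β).answerB x y rA rB =
      bif bobAnswer (n / 2 ^ β) (numOf (List.ofFn rA)) (usedPart (n / 2 ^ β) (List.ofFn x))
        (List.ofFn y) then
      hashKey (n / 2 ^ β) (numOf (List.ofFn rA)) (candidate (n / 2 ^ β)
        ((List.ofFn y).take (n / 2 ^ β)) (numOf (List.ofFn rA)) (bitsOf (n / 2 ^ β)
          (shortHash (n / 2 ^ β) (numOf (List.ofFn rA)) (usedPart (n / 2 ^ β) (List.ofFn x)))))
      else [] := by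
  have hs : 0 < n / 2 ^ β := by
    rcases Nat.eq_zero_or_pos (n / 2 ^ β) with h | h
    · rw [h, keyLen_zero] at hk; omega
    · exact h
  have ha : numOf (List.ofFn rA) < 2 ^ (n / 2 ^ β) := numOf_ofFn_lt β rA
  rw [Protocol.answerB, transcript_keyProtocol]
  change (keyRules β).outB _ = _
  rw [keyRules_outB _ _ (by rw [List.length_ofFn]), getD_fullTranscript hs]
  have h1 : ∀ {s a u : ℕ} {ok : Bool}, (fullTranscript s a u ok).take s = bitsOf s a := by
    intro s a u ok
    rw [fullTranscript, aliceBits, List.append_assoc, List.take_left' (by simp)]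
  have h2 : ∀ {s a u : ℕ} {ok : Bool},
      ((fullTranscript s a u ok).drop s).take s = bitsOf s (shortHash s a u) := by
    intro s a u ok
    rw [fullTranscript, aliceBits, List.append_assoc, List.drop_left' (by simp),
      List.take_left' (by simp)]
  rw [h1, h2, numOf_bitsOf ha]

theorem answers_eq_nil_of_keyLen_eq_zero (hk : keyLen (n / 2 ^ β) = 0) :
    (keyProtocol β).answerA x y rA rB = [] ∧ (keyProtocol β).answerB x y rA rB = [] := by
  have h : ∀ (b : Bool) (a u : ℕ), (bif b then hashKey (n / 2 ^ β) a u else []) = [] := by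
    intro b a u
    cases b <;> simp [hashKey, hk]
  constructor
  · simp only [Protocol.answerA, keyProtocol, keyRules, List.length_ofFn, h]
  · simp only [Protocol.answerB, keyProtocol, keyRules, List.length_ofFn, h]

end

/-! ### The hash functions extract randomness -/

theorem usedPart_lt {s n : ℕ} {x : List Bool} (hx : x.length = n) (hs : s ≤ n) :
    usedPart s x < 2 ^ s := by
  have := numOf_lt (x.take s)
  rwa [List.length_take, hx, min_eq_left hs] at this

theorem card_usedPart_eq_le {n s : ℕ} {X : Finset (List Bool)}
    (hX : ∀ x ∈ X, x.length = n) (u : ℕ) :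
    (X.filter fun x => usedPart s x = u).card ≤ 2 ^ (n - s) := by
  rw [← Finset.card_range (2 ^ (n - s))]
  refine Finset.card_le_card_of_injOn (fun x => numOf (x.drop s)) ?_ ?_
  · intro x hx
    have hxn := hX x (Finset.mem_filter.1 hx).1
    have := numOf_lt (x.drop s)
    rw [List.length_drop, hxn] at this
    exact Finset.mem_coe.2 (Finset.mem_range.2 this)
  · intro x hx x' hx' h
    obtain ⟨hx, hu⟩ := Finset.mem_filter.1 hx
    obtain ⟨hx', hu'⟩ := Finset.mem_filter.1 hx'
    have hl : x.length = x'.length := (hX x hx).trans (hX x' hx').symm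
    rw [← List.take_append_drop s x, ← List.take_append_drop s x',
      numOf_injective (by simp [hl]) (hu.trans hu'.symm), numOf_injective (by simp [hl]) h]

/-- A set is hit at most as often as the collisions permit. -/
theorem card_filter_mem_sq_le {α : Type*} [DecidableEq α] (X : Finset α) (V : α → ℕ)
    (T : Finset ℕ) : (X.filter fun x => V x ∈ T).card ^ 2 ≤
      T.card * ((X ×ˢ X).filter fun p => V p.1 = V p.2).card := by
  have h1 : (X.filter fun x => V x ∈ T).card = ∑ v ∈ T, (X.filter fun x => V x = v).card := by
    rw [Finset.card_eq_sum_card_fiberwise (s := X.filter fun x => V x ∈ T) (f := V) (t := T)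
      fun x hx => (Finset.mem_filter.1 hx).2]
    refine Finset.sum_congr rfl fun v hv => ?_
    congr 1
    ext x
    simp only [Finset.mem_filter]
    exact ⟨fun h => ⟨h.1.1, h.2⟩, fun h => ⟨⟨h.1, h.2 ▸ hv⟩, h.2⟩⟩
  rw [h1]
  refine sq_sum_le_card_mul_sum_sq.trans (Nat.mul_le_mul_left _ ?_)
  have h2 : ∀ v ∈ T, (X.filter fun x => V x = v).card ^ 2 ≤
      (((X ×ˢ X).filter fun p => V p.1 = V p.2 ∧ V p.1 ∈ T).filter fun p => V p.1 = v).card := by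
    intro v hv
    rw [sq, ← Finset.card_product]
    refine Finset.card_le_card fun p hp => ?_
    simp only [Finset.mem_product, Finset.mem_filter] at hp ⊢
    exact ⟨⟨⟨hp.1.1, hp.2.1⟩, hp.1.2.trans hp.2.2.symm, hp.1.2 ▸ hv⟩, hp.1.2⟩
  refine (Finset.sum_le_sum h2).trans ?_
  rw [← Finset.card_eq_sum_card_fiberwise (f := fun p : α × α => V p.1) (t := T)
    fun p hp => (Finset.mem_filter.1 hp).2.2]
  exact Finset.card_le_card (Finset.monotone_filter_right _ fun p _ h => h.1)

/-- Count seeds for each pair. Pairs with equal used parts collide for every seed, but each string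
has at most `2 ^ (n - s)` such partners; all other pairs collide for at most `2 ^ (slack s + 2)`
seeds. -/
theorem sum_card_collisions_le {n s : ℕ} (hs : s ≤ n) {X : Finset (List Bool)}
    (hX : ∀ x ∈ X, x.length = n) :
    ∑ a ∈ Finset.range (2 ^ s), ((X ×ˢ X).filter fun p =>
      longHash s a (usedPart s p.1) = longHash s a (usedPart s p.2)).card ≤
      X.card * 2 ^ n + X.card ^ 2 * 2 ^ (slack s + 2) := by
  have hswap := Finset.sum_card_bipartiteAbove_eq_sum_card_bipartiteBelow
    (s := Finset.range (2 ^ s)) (t := X ×ˢ X)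
    (fun a p => longHash s a (usedPart s p.1) = longHash s a (usedPart s p.2))
  simp only [Finset.bipartiteAbove, Finset.bipartiteBelow] at hswap
  rw [hswap]
  have hle : ∀ p ∈ X ×ˢ X, ((Finset.range (2 ^ s)).filter fun a =>
      longHash s a (usedPart s p.1) = longHash s a (usedPart s p.2)).card ≤
      (if usedPart s p.2 = usedPart s p.1 then 2 ^ s else 0) + 2 ^ (slack s + 2) := by
    intro p hp
    obtain ⟨h1, h2⟩ := Finset.mem_product.1 hp
    split_ifs with h
    · refine le_add_right ((Finset.card_filter_le _ _).trans ?_)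
      rw [Finset.card_range]
    · rw [zero_add]
      exact card_hash_collision_le (usedPart_lt (hX _ h1) hs) (usedPart_lt (hX _ h2) hs)
        (Ne.symm h) (slack s + 1)
  refine (Finset.sum_le_sum hle).trans ?_
  rw [Finset.sum_add_distrib, Finset.sum_const, Finset.card_product, smul_eq_mul, ← sq]
  gcongr
  rw [Finset.sum_product, ← smul_eq_mul, ← Finset.sum_const]
  refine Finset.sum_le_sum fun x _ => ?_
  rw [← Finset.sum_filter, Finset.sum_const, smul_eq_mul]
  refine (Nat.mul_le_mul_right (2 ^ s) (card_usedPart_eq_le (s := s) hX (usedPart s x))).trans_eq ?_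
  rw [← pow_add, Nat.sub_add_cancel hs]

/-- Only few strings have hash values in small sets `T a` for many seeds `a`. -/
theorem card_le_of_longHash_mem {n s D : ℕ} (hs : s ≤ n) (hD : 24 ≤ D) (hDk : D ≤ keyLen s)
    {X : Finset (List Bool)} (hX : ∀ x ∈ X, x.length = n) (T : ℕ → Finset ℕ)
    (hT : ∀ a, (T a).card ≤ 2 ^ (hashLen s + (keyLen s - D)))
    (hbad : ∀ x ∈ X, 2 ^ s ≤ 1000 * ((Finset.range (2 ^ s)).filter fun a =>
      longHash s a (usedPart s x) ∈ T a).card) :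
    X.card ≤ 2 ^ (n - slack s) := by
  have hlen := hashLen_add_keyLen_add (s := s) (by omega)
  set M := 2 ^ (hashLen s + (keyLen s - D)) with hM
  set A := X.card with hA
  let N : ℕ → ℕ := fun a => (X.filter fun x => longHash s a (usedPart s x) ∈ T a).card
  have h1 : A * 2 ^ s ≤ 1000 * ∑ a ∈ Finset.range (2 ^ s), N a := by
    have hswap := Finset.sum_card_bipartiteAbove_eq_sum_card_bipartiteBelow
      (s := Finset.range (2 ^ s)) (t := X) (fun a x => longHash s a (usedPart s x) ∈ T a)
    simp only [Finset.bipartiteAbove, Finset.bipartiteBelow] at hswap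
    rw [hswap, Finset.mul_sum, hA, ← smul_eq_mul, ← Finset.sum_const]
    exact Finset.sum_le_sum hbad
  -- Cauchy–Schwarz is used twice: over the seeds, and for each seed over the values in `T a`.
  have h2 : (∑ a ∈ Finset.range (2 ^ s), N a) ^ 2 ≤
      2 ^ s * (M * (A * 2 ^ n + A ^ 2 * 2 ^ (slack s + 2))) := by
    refine sq_sum_le_card_mul_sum_sq.trans ?_
    rw [Finset.card_range]
    refine Nat.mul_le_mul_left _ ?_
    refine le_trans (Finset.sum_le_sum fun a _ => (card_filter_mem_sq_le X
      (fun x => longHash s a (usedPart s x)) (T a)).trans (Nat.mul_le_mul_right _ (hT a))) ?_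
    rw [← Finset.mul_sum]
    exact Nat.mul_le_mul_left _ (sum_card_collisions_le hs hX)
  rcases Nat.eq_zero_or_pos A with h0 | h0
  · rw [h0]; exact Nat.zero_le _
  have h3 : (A * 2 ^ s) ^ 2 ≤ 1000 ^ 2 *
      (2 ^ s * (M * (A * 2 ^ n + A ^ 2 * 2 ^ (slack s + 2)))) := by
    refine (Nat.pow_le_pow_left h1 2).trans ?_
    rw [mul_pow]
    exact Nat.mul_le_mul_left _ h2
  -- The discarded digits pay off here: they make the sets `T a` smaller by a factor `2 ^ slack s`,
  -- which becomes the gain in the bound for `X`.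
  have hM1 : M * 2 ^ D * 2 ^ slack s = 2 ^ s := by
    rw [hM, ← pow_add, ← pow_add]
    congr 1
    omega
  have hD' : 2 ^ 24 ≤ 2 ^ D := Nat.pow_le_pow_right (by norm_num) hD
  have hM2 : 2 ^ 24 * (M * 2 ^ slack s) ≤ 2 ^ s := by
    rw [← hM1]
    nlinarith [Nat.zero_le (M * 2 ^ slack s)]
  have hn : 2 ^ (n - slack s) * 2 ^ slack s = 2 ^ n := by
    rw [← pow_add]
    congr 1
    omega
  -- division of the inequality by `A * 2 ^ s`
  have h4 : A * 2 ^ s ≤ 1000 ^ 2 * (M * (2 ^ n + A * 2 ^ (slack s + 2))) := by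
    refine Nat.le_of_mul_le_mul_left ?_ (Nat.mul_pos h0 (Nat.two_pow_pos s))
    calc A * 2 ^ s * (A * 2 ^ s) = (A * 2 ^ s) ^ 2 := by ring
      _ ≤ _ := h3
      _ = _ := by ring
  have h5 : A * 2 ^ s ≤ 2 * 1000 ^ 2 * (M * 2 ^ n) := by
    -- The constant 24 comes from `16 * 1000 ^ 2 ≤ 2 ^ 24`: the term from pairs with distinct used
    -- parts is at most a quarter of the left side and is absorbed.
    have : 1000 ^ 2 * (M * (A * 2 ^ (slack s + 2))) * 4 ≤ A * 2 ^ s := by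
      calc 1000 ^ 2 * (M * (A * 2 ^ (slack s + 2))) * 4
          = A * (16 * 1000 ^ 2 * (M * 2 ^ slack s)) := by ring
        _ ≤ A * (2 ^ 24 * (M * 2 ^ slack s)) := by gcongr; norm_num
        _ ≤ A * 2 ^ s := by gcongr
    rw [mul_add, mul_add] at h4
    omega
  refine Nat.le_of_mul_le_mul_right ?_ (Nat.two_pow_pos s)
  refine h5.trans ?_
  calc 2 * 1000 ^ 2 * (M * 2 ^ n) = 2 ^ (n - slack s) * (2 * 1000 ^ 2 * (M * 2 ^ slack s)) := by
        rw [← hn]; ring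
    _ ≤ 2 ^ (n - slack s) * (2 ^ 24 * (M * 2 ^ slack s)) := by gcongr; norm_num
    _ ≤ 2 ^ (n - slack s) * 2 ^ s := by gcongr

/-! ### Secrecy of the key -/

theorem Primrec.usedPart {α : Type*} [Primcodable α] {s : α → ℕ} {x : α → List Bool}
    (hs : Primrec s) (hx : Primrec x) : Primrec fun v => usedPart (s v) (x v) :=
  Primrec.numOf.comp (Primrec.list_take.comp hs hx)

theorem Primrec.fullTranscript {α : Type*} [Primcodable α] {s a u : α → ℕ}
    (hs : Primrec s) (ha : Primrec a) (hu : Primrec u) :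
    Primrec fun v => fullTranscript (s v) (a v) (u v) true := by
  have hr : Primrec fun m : ℕ => List.replicate m true :=
    (Primrec.list_map (f := List.range) (g := fun _ _ => true) Primrec.list_range
      (Primrec.const true)).of_eq fun m => by simp
  exact Primrec.list_append.comp (Primrec.list_append.comp (Primrec.bitsOf.comp hs ha)
    (Primrec.bitsOf.comp hs (Primrec.shortHash hs ha hu))) (hr.comp hs)

/-- The parameter that describes the length `n` and three strings. -/
def profileParam (n q₁ q₂ q₃ : ℕ) : ℕ := Nat.pair n (Nat.pair q₁ (Nat.pair q₂ q₃))

/-- The three strings that are described by a parameter. -/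
def paramStrings (q : ℕ) : List (List Bool) :=
  [nthProg q.unpair.2.unpair.1, nthProg q.unpair.2.unpair.2.unpair.1,
    nthProg q.unpair.2.unpair.2.unpair.2]

theorem paramStrings_profileParam (n q₁ q₂ q₃ : ℕ) :
    paramStrings (profileParam n q₁ q₂ q₃) = [nthProg q₁, nthProg q₂, nthProg q₃] := by
  simp [paramStrings, profileParam]

theorem Primrec.paramStrings : Primrec paramStrings := by
  have h1 : Primrec fun q : ℕ => q.unpair.2 := Primrec.snd.comp Primrec.unpair
  have h2 := h1.comp h1
  exact Primrec.list_cons.comp (Primrec.nthProg.comp (Primrec.fst.comp (Primrec.unpair.comp h1)))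
    (Primrec.list_cons.comp (Primrec.nthProg.comp (Primrec.fst.comp (Primrec.unpair.comp h2)))
    (Primrec.list_cons.comp (Primrec.nthProg.comp (Primrec.snd.comp (Primrec.unpair.comp h2)))
      (Primrec.const [])))

/-- The seeds that lead to a key of small complexity. -/
noncomputable def weakSeeds (U : Machine) (code : List (List Bool) ≃ List Bool) (s u : ℕ)
    (ps : List (List Bool)) : Finset ℕ :=
  (Finset.range (2 ^ s)).filter fun a =>
    condK U (hashKey s a u) (code (fullTranscript s a u true :: ps)) + 24 < keyLen s

/-- Having many weak seeds is an enumerable property of `x`, given `n` and the strings of the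
profile, and `card_le_of_longHash_mem` shows that it is rare. So `x` is described by its index in a
small enumerable set. -/
theorem Machine.IsOptimal.weakSeeds_few_or_plainK_le {U : Machine} (hU : U.IsOptimal)
    {code : List (List Bool) ≃ List Bool} (hcode : code.Computable) (β : ℕ) :
    ∃ c : ℕ, ∀ (n q₁ q₂ q₃ : ℕ) (x : List Bool), x.length = n →
      1000 * (weakSeeds U code (n / 2 ^ β) (usedPart (n / 2 ^ β) x)
        [nthProg q₁, nthProg q₂, nthProg q₃]).card < 2 ^ (n / 2 ^ β) ∨
      plainK U x ≤ n - slack (n / 2 ^ β) + 2 * (profileParam n q₁ q₂ q₃).size + c := by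
  classical
  let f : List Bool × List (List Bool) →. List Bool := fun v => U v.1 (code v.2)
  have hf : Partrec f := hU.1.comp Computable.fst (hcode.1.comp Computable.snd)
  obtain ⟨e, he, hmono, hef⟩ := hf.exists_stages
  let s : ℕ → ℕ := fun q => q.unpair.1 / 2 ^ β
  let Rin : (((ℕ × List Bool) × (List Bool × ℕ)) × ℕ) → ℕ → Prop := fun w i =>
    e w.1.2.2 (nthProg i, fullTranscript (s w.1.1.1) w.2 (usedPart (s w.1.1.1) w.1.2.1) true ::
      paramStrings w.1.1.1) =
    some (hashKey (s w.1.1.1) w.2 (usedPart (s w.1.1.1) w.1.2.1))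
  let R : ((ℕ × List Bool) × (List Bool × ℕ)) → ℕ → Prop := fun v a =>
    ∃ i < 2 ^ (keyLen (s v.1.1) - 24), Rin (v, a) i
  have hRiff : ∀ v a, R v a ↔ ∃ i < 2 ^ (keyLen (s v.1.1) - 24), Rin (v, a) i :=
    fun _ _ => Iff.rfl
  have hs : Primrec s := Primrec.nat_div.comp (Primrec.fst.comp Primrec.unpair) (Primrec.const _)
  have hRin : PrimrecRel Rin := by
    have hq : Primrec fun w : (((ℕ × List Bool) × (List Bool × ℕ)) × ℕ) × ℕ => w.1.1.1.1 :=
      Primrec.fst.comp (Primrec.fst.comp (Primrec.fst.comp Primrec.fst))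
    have hx : Primrec fun w : (((ℕ × List Bool) × (List Bool × ℕ)) × ℕ) × ℕ => w.1.1.2.1 :=
      Primrec.fst.comp (Primrec.snd.comp (Primrec.fst.comp Primrec.fst))
    have hk : Primrec fun w : (((ℕ × List Bool) × (List Bool × ℕ)) × ℕ) × ℕ => w.1.1.2.2 :=
      Primrec.snd.comp (Primrec.snd.comp (Primrec.fst.comp Primrec.fst))
    have ha : Primrec fun w : (((ℕ × List Bool) × (List Bool × ℕ)) × ℕ) × ℕ => w.1.2 :=
      Primrec.snd.comp Primrec.fst
    have hsw := hs.comp hq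
    have hu := Primrec.usedPart hsw hx
    change PrimrecPred fun w : (((ℕ × List Bool) × (List Bool × ℕ)) × ℕ) × ℕ =>
      e w.1.1.2.2 (nthProg w.2, fullTranscript (s w.1.1.1.1) w.1.2
        (usedPart (s w.1.1.1.1) w.1.1.2.1) true :: paramStrings w.1.1.1.1) =
      some (hashKey (s w.1.1.1.1) w.1.2 (usedPart (s w.1.1.1.1) w.1.1.2.1))
    exact PrimrecRel.comp Primrec.eq (he.comp hk ((Primrec.nthProg.comp Primrec.snd).pair
      (Primrec.list_cons.comp (Primrec.fullTranscript hsw ha hu) (Primrec.paramStrings.comp hq))))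
      (Primrec.option_some.comp (Primrec.hashKey hsw ha hu))
  have hR : PrimrecRel R := by
    refine hRin.exists_lt_nat.comp Primrec.id (Primrec.two_pow.comp (Primrec.nat_sub.comp
      (Primrec.keyLen.comp (hs.comp (Primrec.fst.comp (Primrec.fst.comp Primrec.fst))))
      (Primrec.const 24)))
  have hD : Computable₂ fun (v : ℕ × List Bool) (w : List Bool × ℕ) =>
      decide (w.1.length = v.1.unpair.1 ∧
        2 ^ s v.1 ≤ 1000 * Nat.count (R (v, w)) (2 ^ s v.1)) := by
    have hq : Primrec fun v : (ℕ × List Bool) × (List Bool × ℕ) => v.1.1 :=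
      Primrec.fst.comp Primrec.fst
    have hsv := Primrec.two_pow.comp (hs.comp hq)
    refine (PrimrecPred.and (PrimrecRel.comp Primrec.eq (Primrec.list_length.comp
      (Primrec.fst.comp Primrec.snd)) (Primrec.fst.comp (Primrec.unpair.comp hq)))
      (PrimrecRel.comp Primrec.nat_le hsv (Primrec.nat_mul.comp (Primrec.const 1000)
        ((Primrec.nat_count hR).comp Primrec.id hsv)))).decide.to_comp
  obtain ⟨c, hc⟩ := hU.condK_le_of_enumerable hD
  refine ⟨c, fun n q₁ q₂ q₃ x hxn => ?_⟩
  rw [or_iff_not_imp_left, not_lt]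
  intro hweak
  set σ := n / 2 ^ β with hσ
  set q := profileParam n q₁ q₂ q₃ with hq
  set ps := [nthProg q₁, nthProg q₂, nthProg q₃] with hps
  have hqn : q.unpair.1 = n := by simp [hq, profileParam]
  have hsq : s q = σ := by simp only [s, hqn, hσ]
  have hqs : paramStrings q = ps := paramStrings_profileParam n q₁ q₂ q₃
  have hσn : σ ≤ n := Nat.div_le_self _ _
  -- the outputs of the short programs
  have hkey : 24 < keyLen σ := by
    by_contra hcon
    have : weakSeeds U code σ (usedPart σ x) ps = ∅ :=
      Finset.filter_eq_empty_iff.2 fun a _ => by omega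
    rw [this, Finset.card_empty] at hweak
    exact (Nat.two_pow_pos σ).not_ge hweak
  let tr : ℕ → ℕ → List Bool := fun a h =>
    bitsOf σ a ++ bitsOf σ h ++ List.replicate σ true
  -- For every possible message `v.1`, these values join it with the keys that short programs print
  -- from the resulting transcript. The transcript involves `x` only through that message, so one
  -- set `T a` serves all strings at once.
  obtain ⟨T, hT⟩ : ∃ T : ℕ → Finset ℕ, ∀ a, T a =
    (Finset.range (2 ^ hashLen σ) ×ˢ Finset.range (2 ^ (keyLen σ - 24))).image fun v =>
      v.1 * 2 ^ keyLen σ + numOf ((f (nthProg v.2, tr a v.1 :: ps)).toOption.getD []) :=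
    ⟨_, fun _ => rfl⟩
  have hTcard : ∀ a, (T a).card ≤ 2 ^ (hashLen σ + (keyLen σ - 24)) := by
    intro a
    rw [hT]
    refine Finset.card_image_le.trans ?_
    rw [Finset.card_product, Finset.card_range, Finset.card_range, ← pow_add]
  have hTmem : ∀ {x' : List Bool} {N a : ℕ}, R ((q, []), (x', N)) a →
      longHash σ a (usedPart σ x') ∈ T a := by
    intro x' N a h
    rw [hRiff] at h
    simp only [Rin, hsq, hqs] at h
    obtain ⟨i, hi, hin⟩ := h
    have hfm := hef.2 ⟨N, hin⟩
    rw [hT]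
    rw [Finset.mem_image]
    refine ⟨(shortHash σ a (usedPart σ x'), i), ?_, ?_⟩
    · rw [Finset.mem_product, Finset.mem_range, Finset.mem_range]
      exact ⟨shortHash_lt (by omega) _ _, hi⟩
    · have htr : fullTranscript σ a (usedPart σ x') true = tr a (shortHash σ a (usedPart σ x')) :=
        rfl
      rw [htr] at hfm
      simp only
      rw [Option.mem_def.1 (Part.mem_toOption.2 hfm), Option.getD_some, hashKey,
        numOf_bitsOf (Nat.mod_lt _ (Nat.two_pow_pos _)), ← longHash_div (by omega)]
      exact Nat.div_add_mod' _ _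
  obtain ⟨X, hX⟩ : ∃ X : Finset (List Bool), ∀ x', x' ∈ X ↔ x'.length = n ∧
      2 ^ σ ≤ 1000 * ((Finset.range (2 ^ σ)).filter fun a =>
        longHash σ a (usedPart σ x') ∈ T a).card := by
    refine ⟨((Finset.range (2 ^ n)).image (bitsOf n)).filter fun x' =>
      2 ^ σ ≤ 1000 * ((Finset.range (2 ^ σ)).filter fun a =>
        longHash σ a (usedPart σ x') ∈ T a).card, fun x' => ?_⟩
    rw [Finset.mem_filter, Finset.mem_image]
    refine and_congr_left fun _ => ⟨?_, fun h => ⟨numOf x', ?_, ?_⟩⟩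
    · rintro ⟨m, _, rfl⟩
      exact length_bitsOf n m
    · exact Finset.mem_range.2 (h ▸ numOf_lt x')
    · rw [← h, bitsOf_numOf]
  refine hc q (n - slack σ) [] x X ?_ ?_ ?_
  · intro x' N h
    have h := of_decide_eq_true h
    simp only [hqn, hsq, Nat.count_eq_card_filter_range] at h
    rw [hX]
    refine ⟨h.1, h.2.trans ?_⟩
    exact Nat.mul_le_mul_left _ (Finset.card_le_card
      (Finset.monotone_filter_right _ fun a _ ha => hTmem ha))
  · exact card_le_of_longHash_mem hσn le_rfl hkey.le (fun x' hx' => ((hX x').1 hx').1) T hTcard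
      fun x' hx' => ((hX x').1 hx').2
  · obtain ⟨N, hN⟩ := exists_le_count_of_monotone (R := fun N a => R ((q, []), (x, N)) a)
      (n := 2 ^ σ) (by
        intro a N N' hN h
        rw [hRiff] at h ⊢
        exact h.imp fun i hi => ⟨hi.1, hmono hN hi.2⟩) (weakSeeds U code σ (usedPart σ x) ps)
      (Finset.filter_subset _ _) le_rfl (by
        intro a ha
        have hw := (Finset.mem_filter.1 ha).2
        obtain ⟨p, hp, hpl⟩ := hU.exists_program (hashKey σ a (usedPart σ x))
          (code (fullTranscript σ a (usedPart σ x) true :: ps))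
        obtain ⟨i, hi, rfl⟩ := exists_nthProg_eq (p := p) (l := keyLen σ - 24) (by omega)
        obtain ⟨N, hN⟩ := hef.1 (show hashKey σ a (usedPart σ x) ∈
          f (nthProg i, fullTranscript σ a (usedPart σ x) true :: ps) from hp)
        refine ⟨N, ?_⟩
        rw [hRiff]
        simp only [Rin, hsq, hqs]
        exact ⟨i, hi, hN⟩)
    refine ⟨N, decide_eq_true ?_⟩
    simp only [hqn, hxn, hsq, true_and]
    exact hweak.trans (Nat.mul_le_mul_left _ hN)

/-! ### Hamming balls and typical pairs -/

theorem List.exists_eq_ofFn {α : Type*} {l : List α} {n : ℕ} (h : l.length = n) :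
    ∃ f : Fin n → α, l = List.ofFn f := by
  subst h
  exact ⟨l.get, (List.ofFn_get l).symm⟩

theorem Nat.count_eq_card_filter_fin (p : ℕ → Prop) [DecidablePred p] {s n : ℕ} (hs : s ≤ n) :
    Nat.count p s = (Finset.univ.filter fun i : Fin n => (i : ℕ) < s ∧ p i).card := by
  rw [Nat.count_eq_card_filter_range]
  symm
  refine Finset.card_nbij (fun i : Fin n => (i : ℕ)) ?_ ?_ ?_
  · intro i hi
    have hi := (Finset.mem_filter.1 hi).2
    exact Finset.mem_coe.2 (Finset.mem_filter.2 ⟨Finset.mem_range.2 hi.1, hi.2⟩)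
  · intro i _ j _ h
    exact Fin.ext h
  · intro i hi
    obtain ⟨hi, hp⟩ := Finset.mem_filter.1 hi
    rw [Finset.mem_range] at hi
    exact ⟨⟨i, hi.trans_le hs⟩, Finset.mem_coe.2 (Finset.mem_filter.2
      ⟨Finset.mem_univ _, hi, hp⟩), rfl⟩

theorem listDist_take_ofFn {n s : ℕ} (hs : s ≤ n) (f g : Fin n → Bool) :
    listDist ((List.ofFn f).take s) ((List.ofFn g).take s) =
      (Finset.univ.filter fun i : Fin n => (i : ℕ) < s ∧ f i ≠ g i).card := by
  rw [listDist, List.length_take, List.length_ofFn, min_eq_left hs,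
    Nat.count_eq_card_filter_fin _ hs]
  congr 1
  refine Finset.filter_congr fun i _ => and_congr_right fun hi => ?_
  have h : ∀ f : Fin n → Bool, ((List.ofFn f).take s).getD i false = f i := by
    intro f
    rw [List.getD_eq_getElem _ _ (by simp [hi])]
    simp
  rw [h, h]

theorem listDist_ofFn {n : ℕ} (f g : Fin n → Bool) :
    listDist (List.ofFn f) (List.ofFn g) = hammingDist f g := by
  have := listDist_take_ofFn le_rfl f g
  rw [List.take_of_length_le (by simp), List.take_of_length_le (by simp)] at this
  simp [this, hammingDist]

/-- The exponential moment method for words at distances from `g`. -/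
theorem card_mul_le_of_weights {n s : ℕ} (hs : s ≤ n) (g : Fin n → Bool) (p r μ w : ℝ)
    (hp : 0 ≤ p) (hr : 0 ≤ r) (hμ : 0 ≤ μ) (F : Finset (Fin n → Bool))
    (hF : ∀ f ∈ F, w ≤ p ^ hammingDist f g * r ^ (n - hammingDist f g) *
      μ ^ (Finset.univ.filter fun i : Fin n => (i : ℕ) < s ∧ f i ≠ g i).card) :
    F.card * w ≤ (p * μ + r) ^ s * (p + r) ^ (n - s) := by
  let W : Fin n → Bool → ℝ := fun i b =>
    if b ≠ g i then p * (if (i : ℕ) < s then μ else 1) else r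
  have hW : ∀ i b, 0 ≤ W i b := by
    intro i b
    simp only [W]
    split_ifs <;> positivity
  have hprod : ∀ f : Fin n → Bool, ∏ i, W i (f i) =
      p ^ hammingDist f g * r ^ (n - hammingDist f g) *
        μ ^ (Finset.univ.filter fun i : Fin n => (i : ℕ) < s ∧ f i ≠ g i).card := by
    intro f
    have hc : (Finset.univ.filter fun i => ¬ f i ≠ g i).card = n - hammingDist f g := by
      have := Finset.card_filter_add_card_filter_not (s := (Finset.univ : Finset (Fin n)))
        (fun i => f i ≠ g i)
      rw [Finset.card_univ, Fintype.card_fin] at this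
      rw [hammingDist]
      omega
    simp only [W]
    rw [Finset.prod_ite, Finset.prod_const, hc, Finset.prod_mul_distrib, Finset.prod_const,
      Finset.prod_ite, Finset.prod_const, Finset.prod_const_one, mul_one, Finset.filter_filter]
    simp only [and_comm, hammingDist]
    ring
  have hsum : ∑ f : Fin n → Bool, ∏ i, W i (f i) = (p * μ + r) ^ s * (p + r) ^ (n - s) := by
    have h1 := Finset.prod_univ_sum (fun _ : Fin n => (Finset.univ : Finset Bool)) W
    rw [Fintype.piFinset_univ] at h1
    rw [← h1]
    have h2 : ∀ i : Fin n, ∑ b, W i b = if (i : ℕ) < s then p * μ + r else p + r := by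
      intro i
      simp only [W, Fintype.sum_bool]
      cases g i <;> split_ifs <;> simp_all [add_comm]
    rw [Finset.prod_congr rfl fun i _ => h2 i, Finset.prod_ite, Finset.prod_const,
      Finset.prod_const]
    have hcs : (Finset.univ.filter fun i : Fin n => (i : ℕ) < s).card = s := by
      have := Nat.count_eq_card_filter_fin (fun _ => True) hs
      simpa using this.symm
    have hcn := Finset.card_filter_add_card_filter_not (s := (Finset.univ : Finset (Fin n)))
        (fun i => (i : ℕ) < s)
    rw [Finset.card_univ, Fintype.card_fin, hcs] at hcn
    rw [hcs, show (Finset.univ.filter fun i : Fin n => ¬ (i : ℕ) < s).card = n - s by omega]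
  rw [← hsum, ← nsmul_eq_mul, ← Finset.sum_const]
  refine (Finset.sum_le_sum fun f hf => (hF f hf).trans_eq (hprod f).symm).trans ?_
  exact Finset.sum_le_sum_of_subset_of_nonneg (Finset.subset_univ _)
    fun f _ _ => Finset.prod_nonneg fun i _ => hW i _

section Entropy

variable {θ : ℝ}

/-- Under independent differences of probability `θ`, each word of the ball has probability at least
`θ ^ j * (1 - θ) ^ (s - j)`, because `θ < 1 / 2` makes closer words likelier; and the total
probability is 1. -/
theorem ballCount_le_exp (hθ₀ : 0 < θ) (hθ₁ : θ < 1 / 2) {s j u : ℕ} {y : List Bool}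
    (hy : y.length = s) (hj : listDist (bitsOf s u) y = j) :
    (ballCount s y u : ℝ) ≤ Real.exp (j * -Real.log θ + (s - j) * -Real.log (1 - θ)) := by
  obtain ⟨g, rfl⟩ := List.exists_eq_ofFn hy
  have hjs : j ≤ s := by
    rw [← hj, listDist, length_bitsOf]
    exact Nat.count_le _
  let φ : ℕ → Fin s → Bool := fun v i => (bitsOf s v).getD i false
  have hφ : ∀ v, List.ofFn (φ v) = bitsOf s v := by
    intro v
    refine List.ext_getElem (by simp) fun i h1 h2 => ?_
    simp only [φ, List.getElem_ofFn]
    rw [List.getD_eq_getElem _ _ h2]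
  have h0 : 0 < θ ^ j * (1 - θ) ^ (s - j) := by
    have : 0 < 1 - θ := by linarith
    positivity
  have hcount : ballCount s (List.ofFn g) u ≤
      (Finset.univ.filter fun f : Fin s → Bool => hammingDist f g ≤ j).card := by
    rw [ballCount, Nat.count_eq_card_filter_range, hj]
    refine Finset.card_le_card_of_injOn φ ?_ ?_
    · intro v hv
      have := (Finset.mem_filter.1 hv).2
      rw [← hφ, listDist_ofFn] at this
      exact Finset.mem_coe.2 (Finset.mem_filter.2 ⟨Finset.mem_univ _, this⟩)
    · intro v hv w hw h
      refine bitsOf_injective (Finset.mem_range.1 (Finset.mem_filter.1 hv).1)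
        (Finset.mem_range.1 (Finset.mem_filter.1 hw).1) ?_
      rw [← hφ, ← hφ, h]
  have hw := card_mul_le_of_weights le_rfl g θ (1 - θ) 1 (θ ^ j * (1 - θ) ^ (s - j)) hθ₀.le
    (by linarith) zero_le_one (Finset.univ.filter fun f : Fin s → Bool => hammingDist f g ≤ j) (by
      intro f hf
      have hd := (Finset.mem_filter.1 hf).2
      set d := hammingDist f g
      obtain ⟨m, rfl⟩ := Nat.exists_eq_add_of_le hd
      rw [one_pow, mul_one, show s - d = s - (d + m) + m by omega, pow_add, pow_add]
      have h1 : θ ^ m ≤ (1 - θ) ^ m := pow_le_pow_left₀ hθ₀.le (by linarith) m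
      have h2 : 0 ≤ θ ^ d * (1 - θ) ^ (s - (d + m)) := by
        have : 0 < 1 - θ := by linarith
        positivity
      nlinarith)
  rw [mul_one, add_sub_cancel, one_pow, one_pow, mul_one] at hw
  have hexp : Real.exp (j * -Real.log θ + (s - j) * -Real.log (1 - θ)) =
      (θ ^ j * (1 - θ) ^ (s - j))⁻¹ := by
    rw [← Nat.cast_sub hjs]
    nth_rewrite 1 [← Real.exp_log h0]
    rw [← Real.exp_neg, Real.log_mul (by positivity) (pow_ne_zero _ (by linarith)), Real.log_pow, Real.log_pow]
    ring_nf
  rw [hexp, ← one_div, le_div_iff₀ h0]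
  refine le_trans (mul_le_mul_of_nonneg_right ?_ h0.le) hw
  exact_mod_cast hcount

/-- Few words at distance `k` from `g` differ from `g` more often than usual among the first `s`
positions. -/
theorem card_atypical_le_exp (hθ₀ : 0 < θ) (hθ₁ : θ < 1) {n s : ℕ} (hs : s ≤ n) (j k : ℕ)
    (hk : k ≤ n) (g : Fin n → Bool) {t : ℝ} (ht₀ : 0 ≤ t) (ht₁ : t ≤ 1) :
    ((Finset.univ.filter fun f : Fin n → Bool => hammingDist f g = k ∧
      j ≤ (Finset.univ.filter fun i : Fin n => (i : ℕ) < s ∧ f i ≠ g i).card).card : ℝ) ≤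
    Real.exp (k * -Real.log θ + (n - k) * -Real.log (1 - θ) - t * (j - θ * s) + s * t ^ 2) := by
  have hθ' : 0 < 1 - θ := by linarith
  have h0 : 0 < θ ^ k * (1 - θ) ^ (n - k) * Real.exp t ^ j := by positivity
  have hw := card_mul_le_of_weights hs g θ (1 - θ) (Real.exp t)
    (θ ^ k * (1 - θ) ^ (n - k) * Real.exp t ^ j) hθ₀.le hθ'.le (Real.exp_pos t).le
    (Finset.univ.filter fun f : Fin n → Bool => hammingDist f g = k ∧
      j ≤ (Finset.univ.filter fun i : Fin n => (i : ℕ) < s ∧ f i ≠ g i).card) (by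
      intro f hf
      obtain ⟨h1, h2⟩ := (Finset.mem_filter.1 hf).2
      rw [h1]
      gcongr
      exact Real.one_le_exp ht₀)
  rw [add_sub_cancel, one_pow, mul_one] at hw
  have hexp : (θ * Real.exp t + (1 - θ)) ^ s ≤ Real.exp (θ * s * t + s * t ^ 2) := by
    -- This is where `t ≤ 1` is needed. It bounds the moment of one prefix position by `exp (θ * t +
    -- t ^ 2)`.
    have h1 : Real.exp t ≤ 1 + t + t ^ 2 := by
      have := (abs_le.1 (Real.abs_exp_sub_one_sub_id_le (abs_le.2 ⟨by linarith, ht₁⟩))).2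
      linarith
    have h2 : θ * Real.exp t + (1 - θ) ≤ Real.exp (θ * t + t ^ 2) := by
      have := Real.add_one_le_exp (θ * t + t ^ 2)
      nlinarith [sq_nonneg t]
    refine (pow_le_pow_left₀ (by positivity) h2 s).trans_eq ?_
    rw [← Real.exp_nat_mul]
    ring_nf
  have hval : θ ^ k * (1 - θ) ^ (n - k) * Real.exp t ^ j =
      Real.exp (k * Real.log θ + (n - k) * Real.log (1 - θ) + j * t) := by
    rw [Real.exp_add, Real.exp_add, Real.exp_nat_mul, Real.exp_nat_mul, ← Nat.cast_sub hk,
      Real.exp_nat_mul, Real.exp_log hθ₀, Real.exp_log hθ']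
  have := (le_div_iff₀ h0).2 (hw.trans hexp)
  refine this.trans_eq ?_
  rw [hval, ← Real.exp_sub]
  ring_nf

end Entropy

/-- Strings that differ from `y` in more of the first positions than usual have small conditional
complexity. -/
theorem Machine.IsOptimal.condK_le_of_atypical {U : Machine} (hU : U.IsOptimal) :
    ∃ c : ℕ, ∀ (n s j m : ℕ) (x y : Fin n → Bool), s ≤ n →
      (Finset.univ.filter fun f : Fin n → Bool => hammingDist f y = hammingDist x y ∧
        j ≤ (Finset.univ.filter fun i : Fin n => (i : ℕ) < s ∧ f i ≠ y i).card).card ≤ 2 ^ m →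
      j ≤ (Finset.univ.filter fun i : Fin n => (i : ℕ) < s ∧ x i ≠ y i).card →
      condK U (List.ofFn x) (List.ofFn y) ≤
        m + 2 * (Nat.pair s (Nat.pair j (hammingDist x y))).size + c := by
  have hD : Computable₂ fun (v : ℕ × List Bool) (w : List Bool × ℕ) =>
      decide (w.1.length = v.2.length ∧ listDist w.1 v.2 = v.1.unpair.2.unpair.2 ∧
        v.1.unpair.2.unpair.1 ≤
          listDist (w.1.take v.1.unpair.1) (v.2.take v.1.unpair.1)) := by
    have hq : Primrec fun v : (ℕ × List Bool) × (List Bool × ℕ) => v.1.1.unpair :=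
      Primrec.unpair.comp (Primrec.fst.comp Primrec.fst)
    have hq2 : Primrec fun v : (ℕ × List Bool) × (List Bool × ℕ) => v.1.1.unpair.2.unpair :=
      Primrec.unpair.comp (Primrec.snd.comp hq)
    have hs := Primrec.fst.comp hq
    have hx : Primrec fun v : (ℕ × List Bool) × (List Bool × ℕ) => v.2.1 :=
      Primrec.fst.comp Primrec.snd
    have hy : Primrec fun v : (ℕ × List Bool) × (List Bool × ℕ) => v.1.2 :=
      Primrec.snd.comp Primrec.fst
    exact (PrimrecPred.and
      (PrimrecRel.comp Primrec.eq (Primrec.list_length.comp hx) (Primrec.list_length.comp hy))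
      (PrimrecPred.and
        (PrimrecRel.comp Primrec.eq (Primrec.listDist.comp hx hy) (Primrec.snd.comp hq2))
        (PrimrecRel.comp Primrec.nat_le (Primrec.fst.comp hq2) (Primrec.listDist.comp
          (Primrec.list_take.comp hs hx) (Primrec.list_take.comp hs hy))))).decide.to_comp
  obtain ⟨c, hc⟩ := hU.condK_le_of_enumerable hD
  refine ⟨c, fun n s j m x y hs hcard hj => ?_⟩
  refine hc (Nat.pair s (Nat.pair j (hammingDist x y))) m _ _
    ((Finset.univ.filter fun f : Fin n → Bool => hammingDist f y = hammingDist x y ∧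
        j ≤ (Finset.univ.filter fun i : Fin n => (i : ℕ) < s ∧ f i ≠ y i).card).image List.ofFn)
    ?_ (Finset.card_image_le.trans hcard) ⟨0, ?_⟩
  · intro x' N h
    obtain ⟨hl, hd, hj'⟩ := of_decide_eq_true h
    simp only [Nat.unpair_pair, List.length_ofFn] at hl hd hj'
    obtain ⟨f, rfl⟩ := List.exists_eq_ofFn hl
    rw [listDist_ofFn] at hd
    rw [listDist_take_ofFn hs] at hj'
    exact Finset.mem_image_of_mem _ (Finset.mem_filter.2 ⟨Finset.mem_univ _, hd, hj'⟩)
  · refine decide_eq_true ?_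
    simp only [Nat.unpair_pair, List.length_ofFn, true_and]
    exact ⟨listDist_ofFn x y, by rwa [listDist_take_ofFn hs]⟩

/-! ### Size estimates for the slack and for binary notation -/

theorem slack_le (s : ℕ) : slack s ≤ s :=
  (Nat.mul_le_mul_left _ (Nat.sqrt_le_self _)).trans (Nat.sqrt_le s)

theorem sqrt_le_slack (s : ℕ) : s.sqrt ≤ slack s := by
  rcases Nat.eq_zero_or_pos s.sqrt with h | h
  · simp [h]
  · exact Nat.le_mul_of_pos_right _ (Nat.sqrt_pos.2 h)

/-- An excess of about `slack s` differences has a Chernoff exponent of order `slack s ^ 2 / s`.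
This must be of order `√s` in order to beat logarithms, hence the growth `s ^ (3 / 4)`. -/
theorem mul_sqrt_le_slack_sq (s : ℕ) : s * s.sqrt ≤ 9 * slack s ^ 2 := by
  have h : ∀ m : ℕ, m ≤ 3 * (m.sqrt * m.sqrt) := by
    intro m
    have h1 := Nat.lt_succ_sqrt m
    rw [Nat.succ_eq_add_one] at h1
    rcases Nat.eq_zero_or_pos m with h0 | h0
    · simp [h0]
    · have := Nat.sqrt_pos.2 h0
      nlinarith
  calc s * s.sqrt ≤ 3 * (s.sqrt * s.sqrt) * (3 * (s.sqrt.sqrt * s.sqrt.sqrt)) :=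
        Nat.mul_le_mul (h s) (h s.sqrt)
    _ = 9 * slack s ^ 2 := by rw [slack]; ring

theorem slack_pow_four_le (s : ℕ) : slack s ^ 4 ≤ s ^ 3 := by
  have h1 := Nat.sqrt_le' s
  have h2 := Nat.sqrt_le' s.sqrt
  calc slack s ^ 4 = s.sqrt ^ 4 * (s.sqrt.sqrt ^ 2) ^ 2 := by rw [slack]; ring
    _ ≤ s.sqrt ^ 4 * s.sqrt ^ 2 := by gcongr
    _ = (s.sqrt ^ 2) ^ 3 := by ring
    _ ≤ s ^ 3 := by gcongr

theorem Nat.size_le_two_mul_log {m : ℕ} (hm : 0 < m) : (m.size : ℝ) ≤ 2 * Real.log m + 1 := by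
  obtain ⟨k, hk⟩ := Nat.exists_eq_add_of_lt (Nat.size_pos.2 hm)
  have h1 : 2 ^ k ≤ m := Nat.lt_size.1 (by omega)
  have h2 : (k : ℝ) * Real.log 2 ≤ Real.log m := by
    rw [← Real.log_pow]
    exact Real.log_le_log (by positivity) (by exact_mod_cast h1)
  have h3 := Real.log_two_gt_d9
  have h4 : (m.size : ℝ) = k + 1 := by rw [hk]; push_cast; ring
  rw [h4]
  nlinarith [(Nat.cast_nonneg k : (0 : ℝ) ≤ k)]

theorem bitsOf_usedPart {n s : ℕ} (hs : s ≤ n) (x : Fin n → Bool) :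
    bitsOf s (usedPart s (List.ofFn x)) = (List.ofFn x).take s := by
  have := bitsOf_numOf ((List.ofFn x).take s)
  rwa [List.length_take, List.length_ofFn, min_eq_left hs] at this

/-- Either Alice's string is among those that Bob takes into account, or it has small conditional
complexity. -/
theorem Machine.IsOptimal.ballCount_le_or_condK_le {U : Machine} (hU : U.IsOptimal) {θ : ℝ}
    (hθ₀ : 0 < θ) (hθ₁ : θ < 1 / 2) (hθ : Real.binEntropy θ / Real.log 2 = 1 / 2) :
    ∃ κ > 0, ∃ c : ℝ, ∀ (n s : ℕ) (x y : Fin n → Bool), s ≤ n → 2 ≤ slack s →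
      |(hammingDist x y : ℝ) - θ * n| < 1 →
      ballCount s ((List.ofFn y).take s) (usedPart s (List.ofFn x)) ≤ 2 ^ (s / 2 + slack s) ∨
      (condK U (List.ofFn x) (List.ofFn y) : ℝ) ≤ n / 2 - κ * s.sqrt + 8 * n.size + c := by
  obtain ⟨c, hc⟩ := hU.condK_le_of_atypical
  have hl2 : 0 < Real.log 2 := Real.log_pos one_lt_two
  set α := -Real.log θ with hα
  set γ := -Real.log (1 - θ) with hγ
  have hent : θ * α + (1 - θ) * γ = Real.log 2 / 2 := by
    have : Real.binEntropy θ = Real.log 2 / 2 := by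
      field_simp at hθ
      linarith
    rw [← this, Real.binEntropy, Real.log_inv, Real.log_inv]
  have hγ0 : 0 ≤ γ := neg_nonneg.2 (Real.log_nonpos (by linarith) (by linarith))
  have hγα : γ ≤ α := neg_le_neg (Real.log_le_log hθ₀ (by linarith))
  have hα2 : Real.log 2 ≤ α := by
    rw [hα, ← Real.log_inv]
    refine Real.log_le_log two_pos ?_
    rw [le_inv_comm₀ two_pos hθ₀]
    linarith
  have hα0 : 0 < α := hl2.trans_le hα2
  -- Here `144 = 16 * 9`: the 16 comes from `e ^ 2 / (4 * s)` with `e = L * log 2 / (2 * α)`, the 9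
  -- from `mul_sqrt_le_slack_sq`. One factor `log 2` is lost in passing to bits.
  refine ⟨Real.log 2 / (144 * α ^ 2), by positivity, α / Real.log 2 + 1 + c,
    fun n s x y hs hsl hd => ?_⟩
  set j := listDist ((List.ofFn x).take s) ((List.ofFn y).take s) with hj
  have hjc := listDist_take_ofFn hs x y
  set L : ℝ := (slack s : ℝ) with hL
  have hL2 : (2 : ℝ) ≤ L := by rw [hL]; exact_mod_cast hsl
  have hLs : L ≤ s := by rw [hL]; exact_mod_cast slack_le s
  have hs0 : (0 : ℝ) < s := by linarith
  -- Each difference beyond `θ s` enlarges the ball bound by a factor `exp (α - γ) ≤ exp α`, so this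
  -- is the excess that the slack allows; the `-1` covers the rounding of `s / 2`.
  rcases le_or_gt ((j - θ * s) * α) ((L - 1) * Real.log 2) with hcase | hcase
  · left
    have h1 := ballCount_le_exp hθ₀ hθ₁ (y := (List.ofFn y).take s) (s := s) (j := j)
      (u := usedPart s (List.ofFn x)) (by simp [hs]) (by rw [bitsOf_usedPart hs])
    have h2 : (j : ℝ) * α + (s - j) * γ ≤ ((s / 2 : ℕ) + L) * Real.log 2 := by
      have h3 : (j : ℝ) * α + (s - j) * γ = s * (Real.log 2 / 2) + (j - θ * s) * (α - γ) := by
        rw [← hent]; ring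
      have h4 : (s : ℝ) / 2 ≤ (s / 2 : ℕ) + 1 := by
        have : s ≤ 2 * (s / 2) + 2 := by omega
        have : (s : ℝ) ≤ 2 * (s / 2 : ℕ) + 2 := by exact_mod_cast this
        linarith
      have h5 : (j - θ * s) * (α - γ) ≤ (L - 1) * Real.log 2 := by
        rcases le_total 0 (j - θ * s) with h | h
        · nlinarith
        · have : (j - θ * s) * (α - γ) ≤ 0 :=
            mul_nonpos_of_nonpos_of_nonneg h (by linarith)
          have : 0 ≤ (L - 1) * Real.log 2 := mul_nonneg (by linarith) hl2.le
          linarith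
      rw [h3]
      nlinarith
    have h6 : Real.exp (((s / 2 : ℕ) + L) * Real.log 2) = (2 : ℝ) ^ (s / 2 + slack s) := by
      rw [hL, ← Nat.cast_add, mul_comm, ← Real.rpow_def_of_pos two_pos, Real.rpow_natCast]
    have h7 := (h1.trans (Real.exp_le_exp.2 h2)).trans_eq h6
    exact_mod_cast h7
  · right
    set k := hammingDist x y with hk
    have hkn : k ≤ n := by
      simpa using hammingDist_le_card_fintype (x := x) (y := y)
    set e := L * Real.log 2 / (2 * α) with he
    have he0 : 0 < e := by positivity
    have heE : e ≤ j - θ * s := by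
      rw [he, div_le_iff₀ (by positivity)]
      nlinarith
    have heL : e ≤ L := by
      rw [he, div_le_iff₀ (by positivity)]
      nlinarith
    -- The value `t = e / (2 * s)` minimises `-t * e + s * t ^ 2`, with minimum `-e ^ 2 / (4 * s)`.
    have hcard := card_atypical_le_exp hθ₀ (by linarith) hs j k hkn y (t := e / (2 * s))
      (by positivity) (by rw [div_le_one (by positivity)]; linarith)
    rw [← hα, ← hγ] at hcard
    set F := Finset.univ.filter fun f : Fin n → Bool => hammingDist f y = k ∧
      j ≤ (Finset.univ.filter fun i : Fin n => (i : ℕ) < s ∧ f i ≠ y i).card with hF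
    have hxF : x ∈ F := Finset.mem_filter.2 ⟨Finset.mem_univ _, rfl, hjc.le⟩
    -- The summand `α` pays for the rounding of the distance `θ n` to an integer.
    set X : ℝ := n * (Real.log 2 / 2) + α - s.sqrt * (Real.log 2 ^ 2 / (144 * α ^ 2)) with hX
    have hexp : k * α + (n - k) * γ - e / (2 * s) * (j - θ * s) + s * (e / (2 * s)) ^ 2 ≤ X := by
      have h1 : k * α + (n - k) * γ = n * (Real.log 2 / 2) + (k - θ * n) * (α - γ) := by
        rw [← hent]; ring
      have h2 : (k - θ * n) * (α - γ) ≤ α := by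
        have := (abs_lt.1 hd).2
        nlinarith
      have h3 : e / (2 * s) * e ≤ e / (2 * s) * (j - θ * s) :=
        mul_le_mul_of_nonneg_left heE (by positivity)
      have h4 : e / (2 * s) * e - s * (e / (2 * s)) ^ 2 = e ^ 2 / (4 * s) := by
        field_simp; ring
      have h5 : s.sqrt * (Real.log 2 ^ 2 / (144 * α ^ 2)) ≤ e ^ 2 / (4 * s) := by
        have h6 : (s.sqrt : ℝ) ≤ 9 * L ^ 2 / s := by
          rw [le_div_iff₀ hs0, hL, mul_comm]
          exact_mod_cast mul_sqrt_le_slack_sq s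
        have h7 : e ^ 2 / (4 * s) = 9 * L ^ 2 / s * (Real.log 2 ^ 2 / (144 * α ^ 2)) := by
          rw [he]; field_simp; ring
        rw [h7]
        exact mul_le_mul_of_nonneg_right h6 (by positivity)
      rw [hX]
      linarith
    have hFX : (F.card : ℝ) ≤ Real.exp X := hcard.trans (Real.exp_le_exp.2 hexp)
    have hX0 : 0 ≤ X := by
      have h1 : (1 : ℝ) ≤ F.card := by exact_mod_cast Finset.card_pos.2 ⟨x, hxF⟩
      exact Real.one_le_exp_iff.1 (h1.trans hFX)
    have hFm : F.card ≤ 2 ^ ⌈X / Real.log 2⌉₊ := by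
      have h1 : Real.exp X ≤ (2 : ℝ) ^ ⌈X / Real.log 2⌉₊ := by
        rw [← Real.rpow_natCast, Real.rpow_def_of_pos two_pos, Real.exp_le_exp]
        have := Nat.le_ceil (X / Real.log 2)
        rw [div_le_iff₀ hl2] at this
        linarith
      exact_mod_cast hFX.trans h1
    have hmain := hc n s j ⌈X / Real.log 2⌉₊ x y hs hFm hjc.le
    rw [← hk] at hmain
    have hceil := (Nat.ceil_lt_add_one (div_nonneg hX0 hl2.le)).le
    have hjn : j ≤ n := by
      rw [hj, hjc]
      exact (Finset.card_filter_le _ _).trans_eq (by simp)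
    have hsize : (Nat.pair s (Nat.pair j k)).size ≤ 4 * n.size := by
      have := Nat.size_pair_le (a := s) (b := Nat.pair j k) (s := 2 * n.size)
        ((Nat.size_le_size hs).trans (by omega))
        (Nat.size_pair_le (Nat.size_le_size hjn) (Nat.size_le_size hkn))
      omega
    have hmain' : (condK U (List.ofFn x) (List.ofFn y) : ℝ) ≤
        ⌈X / Real.log 2⌉₊ + 8 * n.size + c := by
      have : condK U (List.ofFn x) (List.ofFn y) ≤ ⌈X / Real.log 2⌉₊ + 8 * n.size + c := by
        omega
      exact_mod_cast this
    have hXdiv : X / Real.log 2 =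
        n / 2 + α / Real.log 2 - Real.log 2 / (144 * α ^ 2) * s.sqrt := by
      rw [hX]; field_simp
    linarith

/-! ### Asymptotics -/

theorem tendsto_sqrt_div (B : ℕ) (hB : 0 < B) :
    Tendsto (fun n : ℕ => (n / B).sqrt) atTop atTop := by
  refine tendsto_atTop_atTop.2 fun b => ⟨b * b * B, fun n hn => ?_⟩
  rw [Nat.le_sqrt]
  exact (Nat.le_div_iff_mul_le hB).2 hn

/-- With `r = √s` rounded down, `n + 2` is at most a constant times `(r + 1) ^ 2`, so its logarithm
is `o(r)`. Both contradictions in the main argument rest on this. -/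
theorem eventually_log_lt_sqrt (β : ℕ) (a b : ℝ) {κ : ℝ} (hκ : 0 < κ) :
    ∀ᶠ n : ℕ in atTop, a * Real.log (n + 2) + b < κ * ((n / 2 ^ β).sqrt : ℕ) := by
  have h1 : ∀ᶠ r : ℝ in atTop, ‖Real.log r‖ ≤ κ / (8 * (|a| + 1)) * ‖r‖ :=
    Real.isLittleO_log_id_atTop.bound (by positivity)
  have h2 : Tendsto (fun n : ℕ => (((n / 2 ^ β).sqrt : ℕ) : ℝ)) atTop atTop :=
    tendsto_natCast_atTop_atTop.comp (tendsto_sqrt_div _ (Nat.two_pow_pos β))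
  have h3 := (tendsto_atTop_add_const_right _ 1 h2).eventually h1
  have h4 := h2.eventually (eventually_ge_atTop
    ((4 * (|a| * Real.log (2 ^ (β + 1)) + |b|) + 1) / κ + 1))
  filter_upwards [h3, h4] with n h3 h4
  set r : ℝ := (((n / 2 ^ β).sqrt : ℕ) : ℝ) with hr
  have hrκ : 4 * (|a| * Real.log (2 ^ (β + 1)) + |b|) + 1 ≤ κ * (r - 1) := by
    have := (div_le_iff₀ hκ).1 (by linarith : (4 * (|a| * Real.log (2 ^ (β + 1)) + |b|) + 1) / κ
      ≤ r - 1)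
    linarith
  have hlogβ : 0 ≤ Real.log (2 ^ (β + 1)) := Real.log_nonneg (one_le_pow₀ one_le_two)
  have hr1 : 1 ≤ r := by
    have : 0 ≤ (4 * (|a| * Real.log (2 ^ (β + 1)) + |b|) + 1) / κ := by positivity
    linarith
  have hn : (n : ℝ) + 2 ≤ 2 ^ (β + 1) * (r + 1) ^ 2 := by
    have h5 : n / 2 ^ β < ((n / 2 ^ β).sqrt + 1) ^ 2 := Nat.lt_succ_sqrt' _
    have h6 : n < 2 ^ β * ((n / 2 ^ β).sqrt + 1) ^ 2 := by
      have h := Nat.lt_mul_div_succ n (Nat.two_pow_pos β)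
      exact h.trans_le (Nat.mul_le_mul_left _ h5)
    have h7 : (n : ℝ) ≤ 2 ^ β * (r + 1) ^ 2 := by
      rw [hr]; exact_mod_cast h6.le
    have h8 : (1 : ℝ) ≤ 2 ^ β := one_le_pow₀ one_le_two
    rw [pow_succ]
    nlinarith
  have hlog : Real.log (n + 2) ≤ Real.log (2 ^ (β + 1)) + 2 * Real.log (r + 1) := by
    rw [← Real.log_rpow (by linarith), ← Real.log_mul (by positivity) (by positivity)]
    refine Real.log_le_log (by positivity) ?_
    exact_mod_cast hn
  have hl3 : Real.log (r + 1) ≤ κ / (8 * (|a| + 1)) * (r + 1) := by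
    refine (le_abs_self _).trans (h3.trans_eq ?_)
    rw [Real.norm_of_nonneg (by linarith)]
  have hl0 : 0 ≤ Real.log (n + 2) := Real.log_nonneg (by linarith [Nat.cast_nonneg (α := ℝ) n])
  have h9 : |a| * (2 * (κ / (8 * (|a| + 1)) * (r + 1))) ≤ κ / 4 * (r + 1) := by
    have h10 : |a| * (2 * (κ / (8 * (|a| + 1)) * (r + 1))) =
        |a| / (|a| + 1) * (κ / 4 * (r + 1)) := by field_simp; ring
    rw [h10]
    refine mul_le_of_le_one_left (by positivity) ?_
    rw [div_le_one (by positivity)]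
    linarith
  calc a * Real.log (n + 2) + b ≤ |a| * Real.log (n + 2) + |b| :=
        add_le_add (mul_le_mul_of_nonneg_right (le_abs_self a) hl0) (le_abs_self b)
    _ ≤ |a| * (Real.log (2 ^ (β + 1)) + 2 * (κ / (8 * (|a| + 1)) * (r + 1))) + |b| := by
        gcongr; linarith
    _ = |a| * Real.log (2 ^ (β + 1)) + |b| + |a| * (2 * (κ / (8 * (|a| + 1)) * (r + 1))) := by
        ring
    _ < κ * r := by nlinarith

/-! ### Hamming pairs of large length -/

theorem length_intBits (i : ℤ) : (intBits i).length = i.natAbs.size + 1 := by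
  rw [intBits, List.length_cons, Nat.size_eq_bits_len]

theorem exists_nthProg_intBits (i : ℤ) {N : ℕ} (hi : i.natAbs ≤ N) :
    ∃ q : ℕ, q.size ≤ N.size + 2 ∧ nthProg q = intBits i := by
  obtain ⟨q, hq, hqi⟩ := exists_nthProg_eq (Nat.lt_succ_self (intBits i).length)
  refine ⟨q, (Nat.size_le.2 hq).trans ?_, hqi⟩
  rw [length_intBits]
  have := Nat.size_le_size hi
  omega

/-- For long Hamming pairs, Alice's string is among those that Bob takes into account, and few
seeds lead to a weak key. -/
theorem Machine.IsOptimal.eventually_ballCount_le_and_weakSeeds {U : Machine} (hU : U.IsOptimal)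
    {code : List (List Bool) ≃ List Bool} (hcode : code.Computable) {θ : ℝ}
    (hθ₀ : 0 < θ) (hθ₁ : θ < 1 / 2) (hθ : Real.binEntropy θ / Real.log 2 = 1 / 2)
    (β : ℕ) (K : ℝ) :
    ∀ᶠ n : ℕ in atTop, ∀ x y : Fin n → Bool, IsHammingPair U code θ K x y →
      ballCount (n / 2 ^ β) ((List.ofFn y).take (n / 2 ^ β))
        (usedPart (n / 2 ^ β) (List.ofFn x)) ≤ 2 ^ (n / 2 ^ β / 2 + slack (n / 2 ^ β)) ∧
      1000 * (weakSeeds U code (n / 2 ^ β) (usedPart (n / 2 ^ β) (List.ofFn x))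
        (complexityProfile U code (List.ofFn x) (List.ofFn y))).card < 2 ^ (n / 2 ^ β) := by
  obtain ⟨c₀, hc₀⟩ := hU.condK_le_length
  obtain ⟨c₁, hc₁⟩ := hU.plainK_add_condK_le hcode
  obtain ⟨c₂, hc₂⟩ := hU.weakSeeds_few_or_plainK_le hcode β
  obtain ⟨κ, hκ, c₃, hc₃⟩ := hU.ballCount_le_or_condK_le hθ₀ hθ₁ hθ
  set k : ℕ := ⌈|K|⌉₊ with hk
  have hKk : |K| ≤ k := Nat.le_ceil _
  set m₀ : ℕ := 2 * c₀ + k + 4 with hm₀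
  set b₀ : ℝ := 2 * Real.log m₀ + 1 with hb₀
  filter_upwards [eventually_log_lt_sqrt β (K + 16) (8 * b₀ + c₃) hκ,
    eventually_log_lt_sqrt β (2 * K + 2 * c₁ + 32) ((c₁ + 16) * b₀ + c₁ + 32 * 2 + c₂) one_pos,
    (tendsto_sqrt_div _ (Nat.two_pow_pos β)).eventually_ge_atTop 2] with n h1 h2 h3 x y hxy
  set s := n / 2 ^ β with hs
  have hsn : s ≤ n := Nat.div_le_self _ _
  have hrs := sqrt_le_slack s
  set X := List.ofFn x with hX
  set Y := List.ofFn y with hY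
  set ℓ := Real.log (n + 2) with hℓ
  have hℓ0 : 0 ≤ ℓ := Real.log_nonneg (by linarith [Nat.cast_nonneg (α := ℝ) n])
  have hℓn : ℓ ≤ n + 1 := by
    have := Real.log_le_sub_one_of_pos (x := (n : ℝ) + 2) (by positivity)
    linarith
  have hKℓ : |K * ℓ| ≤ k * (n + 1) := by
    rw [abs_mul, abs_of_nonneg hℓ0]
    exact mul_le_mul hKk hℓn hℓ0 (by positivity)
  have hKℓ' := abs_le.1 hKℓ
  -- A crude linear bound for the profile values and `C(x, y) + 1`; only its binary length, which is
  -- `O(log n)`, matters.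
  set N := m₀ * (n + 2) with hN
  have hNsize : (N.size : ℝ) ≤ 2 * ℓ + b₀ := by
    have h := Nat.size_le_two_mul_log (m := N) (by positivity)
    rw [hN, Nat.cast_mul, Real.log_mul (by positivity) (by positivity)] at h
    push_cast at h
    rw [hb₀]
    linarith
  have hNval : (N : ℝ) = 2 * (c₀ * n) + k * n + 4 * n + 4 * c₀ + 2 * k + 8 := by
    rw [hN, hm₀]; push_cast; ring
  have hnn : (0 : ℝ) ≤ n := Nat.cast_nonneg n
  have hcc : (0 : ℝ) ≤ c₀ * n := by positivity
  have hkn : (0 : ℝ) ≤ k * n := by positivity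
  have hck : (0 : ℝ) ≤ c₀ := Nat.cast_nonneg _
  have hkk : (0 : ℝ) ≤ k := Nat.cast_nonneg _
  have hCx : plainK U X ≤ n + c₀ := (hc₀ X []).trans_eq (by simp [hX])
  have hCy : plainK U Y ≤ n + c₀ := (hc₀ Y []).trans_eq (by simp [hY])
  have hCxR : (plainK U X : ℝ) ≤ n + c₀ := by exact_mod_cast hCx
  have hCyR : (plainK U Y : ℝ) ≤ n + c₀ := by exact_mod_cast hCy
  have hI := abs_le.1 hxy.info
  have hc := abs_le.1 hxy.cond_left
  have hIdef : (mutualInfo U code X Y : ℝ) = plainK U X + plainK U Y - tupleK U code [X, Y] := by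
    rw [mutualInfo]; push_cast; ring
  have hCxN : plainK U X ≤ N := by
    have : (plainK U X : ℝ) ≤ N := by rw [hNval]; linarith
    exact_mod_cast this
  have hCyN : plainK U Y ≤ N := by
    have : (plainK U Y : ℝ) ≤ N := by rw [hNval]; linarith
    exact_mod_cast this
  -- The bound on `C(x, y)` comes from the given `I(x : y)` and the bounds for `C(x)` and `C(y)`.
  have hTN : tupleK U code [X, Y] + 1 ≤ N := by
    have : (tupleK U code [X, Y] : ℝ) + 1 ≤ N := by rw [hNval]; linarith
    exact_mod_cast this
  have hIN : (mutualInfo U code X Y).natAbs ≤ N := by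
    have : |(mutualInfo U code X Y : ℝ)| ≤ N := by
      rw [hNval, abs_le]
      constructor <;> linarith
    rw [← Int.cast_abs, Int.abs_eq_natAbs] at this
    exact_mod_cast this
  have hnN : n.size ≤ N.size := Nat.size_le_size
    ((Nat.le_add_right n 2).trans (Nat.le_mul_of_pos_left _ (by omega)))
  constructor
  · refine (hc₃ n s x y hsn (h3.trans hrs) hxy.dist).resolve_right fun hle => ?_
    have hsz : (n.size : ℝ) ≤ N.size := by
      exact_mod_cast hnN
    linarith [hc.1]
  · obtain ⟨q₁, hq₁, hp₁⟩ := exists_nthProg_intBits (plainK U X : ℤ) (N := N) (by simpa using hCxN)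
    obtain ⟨q₂, hq₂, hp₂⟩ := exists_nthProg_intBits (plainK U Y : ℤ) (N := N) (by simpa using hCyN)
    obtain ⟨q₃, hq₃, hp₃⟩ := exists_nthProg_intBits (mutualInfo U code X Y) hIN
    rw [complexityProfile, ← hp₁, ← hp₂, ← hp₃]
    refine (hc₂ n q₁ q₂ q₃ X (by simp [hX])).resolve_right fun hle => ?_
    rw [← hs] at hle
    have hsize : (profileParam n q₁ q₂ q₃).size ≤ 8 * (N.size + 2) := by
      have e1 := Nat.size_pair_le hq₂ hq₃
      have e2 := Nat.size_pair_le (a := q₁) (s := 2 * (N.size + 2)) (by omega) e1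
      have e3 := Nat.size_pair_le (a := n) (s := 2 * (2 * (N.size + 2))) (by omega) e2
      rw [profileParam]
      omega
    have hle' : (plainK U X : ℝ) + slack s ≤ n + 16 * (N.size + 2) + c₂ := by
      have : plainK U X + slack s ≤ n + 16 * (N.size + 2) + c₂ := by
        have := (slack_le s).trans hsn
        omega
      exact_mod_cast this
    -- Together with `C(x) = I(x : y) + C(x, y) - C(y)` this gives `C(x) ≥ I(x : y) + C(x | y) -
    -- O(log n) ≥ n - O(log n)`.
    have hsym : (plainK U Y : ℝ) + condK U X Y ≤
        tupleK U code [X, Y] + c₁ * N.size + c₁ := by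
      have e1 := hc₁ X Y
      have e2 := Nat.mul_le_mul_left c₁ (Nat.size_le_size hTN)
      have : plainK U Y + condK U X Y ≤ tupleK U code [X, Y] + c₁ * N.size + c₁ := by omega
      exact_mod_cast this
    have hrs' : ((s.sqrt : ℕ) : ℝ) ≤ slack s := by exact_mod_cast hrs
    have hcN : (c₁ : ℝ) * N.size ≤ c₁ * (2 * ℓ + b₀) :=
      mul_le_mul_of_nonneg_left hNsize (Nat.cast_nonneg _)
    linarith [hI.1, hc.1]

/-! ### Probability -/

/-- The bad seeds depend on Alice's coins alone, so Bob's coins multiply both counts by the same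
factor. -/
theorem lt_card_filter_of_injective {α : Type*} [Fintype α] {f : α → ℕ}
    (hf : Function.Injective f) (B : Finset ℕ) (hB : 100 * B.card < Fintype.card α)
    {E : α → α → Prop} [DecidablePred fun r : α × α => E r.1 r.2]
    (hE : ∀ a b, f a ∉ B → E a b) :
    99 * Fintype.card (α × α) < 100 * (Finset.univ.filter fun r : α × α => E r.1 r.2).card := by
  classical
  have hbad : (Finset.univ.filter fun r : α × α => ¬ E r.1 r.2).card ≤
      B.card * Fintype.card α := by
    rw [← Finset.card_univ, ← Finset.card_product]
    refine Finset.card_le_card_of_injOn (fun r => (f r.1, r.2)) (fun r hr => ?_) ?_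
    · refine Finset.mem_coe.2 (Finset.mem_product.2 ⟨?_, Finset.mem_univ _⟩)
      by_contra hno
      exact (Finset.mem_filter.1 hr).2 (hE _ _ hno)
    · intro r _ r' _ h
      obtain ⟨h1, h2⟩ := Prod.mk.inj h
      exact Prod.ext (hf h1) h2
  have hsum := Finset.card_filter_add_card_filter_not (s := (Finset.univ : Finset (α × α)))
    (fun r => E r.1 r.2)
  rw [Finset.card_univ, Fintype.card_prod] at hsum
  rw [Fintype.card_prod]
  nlinarith

theorem lt_prob_keyProtocol {β n : ℕ}
    {E : (Fin ((keyProtocol β).coins n) → Bool) → (Fin ((keyProtocol β).coins n) → Bool) → Prop}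
    (B : Finset ℕ) (hB : 100 * B.card < 2 ^ (n / 2 ^ β))
    (hE : ∀ rA rB, numOf (List.ofFn rA) ∉ B → E rA rB) :
    0.99 < (keyProtocol β).prob n E := by
  classical
  have hR : Fintype.card (Fin ((keyProtocol β).coins n) → Bool) = 2 ^ (n / 2 ^ β) := by
    rw [Fintype.card_fun, Fintype.card_bool, Fintype.card_fin]
    rfl
  have h := lt_card_filter_of_injective
    (f := fun r : Fin ((keyProtocol β).coins n) → Bool => numOf (List.ofFn r))
    (fun r r' h => List.ofFn_injective (numOf_injective (by simp) h)) B (by rwa [hR]) hE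
  rw [Protocol.prob, lt_div_iff₀ (by exact_mod_cast Fintype.card_pos)]
  have h' := (Nat.cast_lt (α := ℝ)).2 h
  push_cast at h' ⊢
  linarith

/-! ### Agreement -/

/-- The seeds with which Bob may find a wrong string. -/
def confusingSeeds (s : ℕ) (y : List Bool) (u : ℕ) : Finset ℕ :=
  (Finset.range (2 ^ s)).filter fun a =>
    ∃ v < 2 ^ s, v ≠ u ∧ IsCandidate s y a (bitsOf s (shortHash s a u)) v

/-- It is not assumed that Bob finds a candidate: otherwise both keys are empty. Hence agreement is
likely even for pairs too short for the complexity estimates. -/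
theorem answers_keyProtocol {β n : ℕ} (x y : Fin n → Bool)
    (rA rB : Fin ((keyProtocol β).coins n) → Bool) (hk : 0 < keyLen (n / 2 ^ β))
    (ha : numOf (List.ofFn rA) ∉ confusingSeeds (n / 2 ^ β) ((List.ofFn y).take (n / 2 ^ β))
      (usedPart (n / 2 ^ β) (List.ofFn x))) :
    (keyProtocol β).answerB x y rA rB = (keyProtocol β).answerA x y rA rB := by
  rw [answerA_keyProtocol β x y rA rB hk, answerB_keyProtocol β x y rA rB hk]
  have hlt : numOf (List.ofFn rA) < 2 ^ (n / 2 ^ β) := numOf_ofFn_lt β rA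
  cases hb : bobAnswer (n / 2 ^ β) (numOf (List.ofFn rA)) (usedPart (n / 2 ^ β) (List.ofFn x))
    (List.ofFn y) with
  | false => rfl
  | true =>
    have hcand := of_decide_eq_true hb
    simp only [cond_true]
    congr 1
    by_contra hne
    exact ha (Finset.mem_filter.2 ⟨Finset.mem_range.2 hlt, _, candidate_lt _ _ _ _, hne, hcand⟩)

theorem keyLen_ge {δ : ℝ} {β : ℕ} (hβ : δ ≤ (1 / 2) ^ β) (n : ℕ) :
    δ * n / 2 - (2 * (n : ℝ) ^ (3 / 4 : ℝ) + 22) ≤ keyLen (n / 2 ^ β) := by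
  set s := n / 2 ^ β with hs
  have h1 : n < 2 ^ β * (s + 1) := Nat.lt_mul_div_succ n (Nat.two_pow_pos β)
  have h2 : δ * n ≤ s + 1 := by
    have h3 : (n : ℝ) ≤ 2 ^ β * (s + 1) := by exact_mod_cast h1.le
    have h4 : (1 / 2 : ℝ) ^ β * (2 ^ β * (s + 1)) = s + 1 := by
      rw [← mul_assoc, ← mul_pow]; norm_num
    calc δ * n ≤ (1 / 2) ^ β * n := mul_le_mul_of_nonneg_right hβ (Nat.cast_nonneg n)
      _ ≤ (1 / 2) ^ β * (2 ^ β * (s + 1)) := mul_le_mul_of_nonneg_left h3 (by positivity)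
      _ = s + 1 := h4
  have h5 : (slack s : ℝ) ≤ (n : ℝ) ^ (3 / 4 : ℝ) := by
    have h6 : (slack s : ℝ) ^ 4 ≤ ((n : ℝ) ^ (3 / 4 : ℝ)) ^ 4 := by
      rw [← Real.rpow_mul_natCast (Nat.cast_nonneg n)]
      have h7 : slack s ^ 4 ≤ n ^ 3 :=
        (slack_pow_four_le s).trans (Nat.pow_le_pow_left (Nat.div_le_self _ _) 3)
      have h8 : (3 / 4 : ℝ) * (4 : ℕ) = (3 : ℕ) := by norm_num
      rw [h8, Real.rpow_natCast]
      exact_mod_cast h7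
    exact le_of_pow_le_pow_left₀ (by norm_num) (by positivity) h6
  have h9 : s ≤ 2 * keyLen s + 4 * slack s + 40 := by
    unfold keyLen hashLen; omega
  have h10 : (s : ℝ) ≤ 2 * keyLen s + 4 * slack s + 40 := by exact_mod_cast h9
  linarith

theorem mainTheorem4
    (U : Machine) (hU : U.IsOptimal)
    (code : List (List Bool) ≃ List Bool) (hcode : code.Computable)
    (θ : ℝ) (hθ_pos : 0 < θ) (hθ_lt : θ < 1 / 2)
    (hθ : Real.binEntropy θ / Real.log 2 = 1 / 2) :
    ∃ c : ℝ, ∀ δ : ℝ, 0 < δ → δ < 1 →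
      ∃ P : Protocol,
        (∀ n : ℕ, (P.commComplexity n : ℝ) ≤ c * (δ * n)) ∧
        ∀ K : ℝ, ∃ g : ℕ → ℝ, g =o[atTop] (fun n : ℕ => (n : ℝ)) ∧ ∃ D : ℕ,
          ∀ (n : ℕ) (x y : Fin n → Bool), IsHammingPair U code θ K x y →
            0.99 < P.prob n fun rA rB =>
              P.AgreeOnSecretKey U code (δ * n / 2 - g n) D x y rA rB := by
  -- The transcript has length `3 * s`, and `(1 / 2) ^ (β + 1) < δ` gives `s ≤ 2 * δ * n`.
  refine ⟨6, fun δ hδ₀ hδ₁ => ?_⟩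
  obtain ⟨β, hβ₁, hβ₂⟩ := exists_nat_pow_near_of_lt_one hδ₀ hδ₁.le
    (by norm_num : (0 : ℝ) < 1 / 2) (by norm_num)
  refine ⟨keyProtocol β, fun n => ?_, fun K => ?_⟩
  · have h1 : (((keyProtocol β).commComplexity n : ℕ) : ℝ) ≤ 3 * ((n / 2 ^ β : ℕ) : ℝ) := by
      exact_mod_cast commComplexity_keyProtocol_le β n
    have h2 : ((n / 2 ^ β : ℕ) : ℝ) ≤ (1 / 2) ^ β * n := by
      refine Nat.cast_div_le.trans_eq ?_
      push_cast
      rw [one_div, inv_pow, div_eq_inv_mul]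
    have h3 : (1 / 2 : ℝ) ^ β * n ≤ 2 * δ * n := by
      refine mul_le_mul_of_nonneg_right ?_ (Nat.cast_nonneg n)
      rw [pow_succ] at hβ₁
      linarith
    linarith
  obtain ⟨n₀, hn₀⟩ := eventually_atTop.1
    (hU.eventually_ballCount_le_and_weakSeeds hcode hθ_pos hθ_lt hθ β K)
  -- The summands `n₀` make the length and secrecy demands trivial for `n < n₀`, where only
  -- agreement has to be proved. The 24 is the loss in `weakSeeds`.
  refine ⟨fun n => 2 * (n : ℝ) ^ (3 / 4 : ℝ) + (22 + n₀), ?_, 24 + n₀, fun n x y hxy => ?_⟩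
  · have hnat : Tendsto (fun n : ℕ => (n : ℝ)) atTop atTop := tendsto_natCast_atTop_atTop
    refine IsLittleO.add (IsLittleO.const_mul_left ?_ 2) ?_
    · have h := (tendsto_rpow_neg_atTop (by norm_num : (0 : ℝ) < 1 / 4)).comp hnat
      refine isLittleO_of_tendsto' (Eventually.of_forall fun n h0 => ?_) (h.congr' ?_)
      · rw [h0, Real.zero_rpow (by norm_num)]
      · filter_upwards [eventually_gt_atTop 0] with n hn
        have hn' : (n : ℝ) ≠ 0 := by positivity
        rw [Function.comp_apply, ← Real.rpow_sub_one hn']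
        norm_num
    · exact isLittleO_const_left.2 (Or.inr (tendsto_norm_atTop_atTop.comp hnat))
  set s := n / 2 ^ β with hs
  set u := usedPart s (List.ofFn x) with hu
  have hsn : s ≤ n := Nat.div_le_self _ _
  have hu2 : u < 2 ^ s := usedPart_lt (by simp) hsn
  have hlen := keyLen_ge hβ₂ n
  rw [← hs] at hlen
  have hn₀' : (0 : ℝ) ≤ n₀ := Nat.cast_nonneg _
  rcases Nat.eq_zero_or_pos (keyLen s) with hk | hk
  · refine lt_prob_keyProtocol ∅ (by simp) fun rA rB _ => ?_
    obtain ⟨hA, hB⟩ := answers_eq_nil_of_keyLen_eq_zero β x y rA rB hk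
    refine ⟨[], hA, hB, ?_, Nat.zero_le _⟩
    rw [hk] at hlen
    push_cast at hlen
    simp only [List.length_nil, Nat.cast_zero]
    linarith
  have hconf : 2 ^ 18 * (confusingSeeds s ((List.ofFn y).take s) u).card ≤ 2 ^ s :=
    card_false_candidate_le hk _ hu2
  have hpos := Nat.two_pow_pos s
  rcases lt_or_ge n n₀ with hn | hn
  · refine lt_prob_keyProtocol (confusingSeeds s ((List.ofFn y).take s) u) ?_
      fun rA rB ha => ?_
    · rw [← hs]; omega
    refine ⟨_, rfl, answers_keyProtocol x y rA rB hk ha, ?_, ?_⟩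
    · have h1 : (0 : ℝ) ≤ (n : ℝ) ^ (3 / 4 : ℝ) := by positivity
      have h2 : (n : ℝ) ≤ n₀ := by exact_mod_cast hn.le
      have h3 : δ * n ≤ n := mul_le_of_le_one_left (Nat.cast_nonneg n) hδ₁.le
      have h4 : (0 : ℝ) ≤ ((keyProtocol β).answerA x y rA rB).length := Nat.cast_nonneg _
      have h5 : (0 : ℝ) ≤ n := Nat.cast_nonneg n
      linarith
    · have h1 : ((keyProtocol β).answerA x y rA rB).length ≤ keyLen s := by
        rw [answerA_keyProtocol β x y rA rB hk]
        cases bobAnswer _ _ _ _ <;> simp [hashKey, hs]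
      have h2 : keyLen s ≤ s := (Nat.sub_le _ _).trans (Nat.sub_le _ _)
      omega
  · classical
    obtain ⟨hball, hweak⟩ := hn₀ n hn x y hxy
    refine lt_prob_keyProtocol (confusingSeeds s ((List.ofFn y).take s) u ∪
      weakSeeds U code s u (complexityProfile U code (List.ofFn x) (List.ofFn y))) ?_
      fun rA rB ha => ?_
    -- The fractions of bad seeds add up to less than `2 ^ (-18) + 1 / 1000`, which is below `1 /
    -- 100`.
    · have := Finset.card_union_le (confusingSeeds s ((List.ofFn y).take s) u)
        (weakSeeds U code s u (complexityProfile U code (List.ofFn x) (List.ofFn y)))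
      rw [← hs, ← hu] at hweak
      rw [← hs]
      omega
    rw [Finset.mem_union, not_or] at ha
    have hlt : numOf (List.ofFn rA) < 2 ^ s := numOf_ofFn_lt β rA
    have hok : bobAnswer s (numOf (List.ofFn rA)) u (List.ofFn y) = true :=
      candidateExists_eq_true hu2 ⟨hball, rfl⟩
    have hA : (keyProtocol β).answerA x y rA rB = hashKey s (numOf (List.ofFn rA)) u := by
      rw [answerA_keyProtocol β x y rA rB hk, ← hs, ← hu, hok, cond_true]
    refine ⟨_, hA, (answers_keyProtocol x y rA rB hk ha.1).trans hA, ?_, ?_⟩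
    · rw [hashKey, length_bitsOf]
      linarith
    · have hnw : ¬ condK U (hashKey s (numOf (List.ofFn rA)) u)
          (code (fullTranscript s (numOf (List.ofFn rA)) u true ::
            complexityProfile U code (List.ofFn x) (List.ofFn y))) + 24 < keyLen s :=
        fun h => ha.2 (Finset.mem_filter.2 ⟨Finset.mem_range.2 hlt, h⟩)
      rw [transcript_keyProtocol, ← hs, ← hu, hok, hashKey, length_bitsOf]
      rw [hashKey] at hnw
      omega
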